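/- Let $n\ge 1$, $-\infty\le a<b\le\infty$ and $f\colon(a,b)\to\mathbb R$. Write $\Delta_h g(x)=g(x+h)-g(x)$. The function $f$ is called $n$-Wright-convex on $(a,b)$ if $\Delta_{h_{n+1}}\cdots\Delta_{h_1}f(x)\ge 0$ for all $h_1,\dots,h_{n+1}>0$ and all $x\in(a,b)$ with $x+h_1+\dots+h_{n+1}\in(a,b)$. For $m\ge2$, a function $g$ on an open interval $I$ is called $m$-times monotone non-decreasing (respectively non-increasing) if for every $k=0,\dots,m-2$ the function $g^{(k)}$ exists on $I$ and is non-negative, non-decreasing and convex (respectively, $(-1)^kg^{(k)}$ exists on $I$ and is non-negative, non-increasing and convex). A polynomial function of degree at most $n$ is a (possibly discontinuous) function $P\colon\mathbb R\to\mathbb R$ with $(\Delta_h)^{n+1}P(x)=0$ for all $h,x\in\mathbb R$. Then $f$ is $n$-Wright-convex on $(a,b)$ if and only if there is $\xi\in[a,b]$ such that $$f(x)=M_1(x)+M_2(x)+Q(x)+P(x)\qquad(x\in(a,b)),$$ where $(-1)^{n+1}M_1$ is $(n+1)$-times monotone non-increasing on $(a,\xi)$ and $M_1=0$ on $(\xi,b)$;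 $M_2$ is $(n+1)$-times monotone non-decreasing on $(\xi,b)$ and $M_2=0$ on $(a,\xi)$; $M_1+M_2$ is of class $C^{n-1}$ on $(a,b)$ (for $n=1$: continuous); $Q$ is a polynomial of degree at most $n$; and $P$ is a polynomial function of degree at most $n$. Moreover, if $f$ is $n$-Wright-convex on $(a,b)$, the decomposition can be chosen so that, with $Q(x)=c_nx^n/n!+\dots+c_0$: if $M_1\equiv0$ on $(a,\xi)$ and $M_2\not\equiv0$ on $(\xi,b)$, then $c_n\ge0$; if $M_2\equiv0$ on $(\xi,b)$ and $M_1\not\equiv0$ on $(a,\xi)$, then $c_n\le0$; and if $M_1\not\equiv0$ on $(a,\xi)$ and $M_2\not\equiv0$ on $(\xi,b)$, then $c_n=0$ and $M_1(\xi-)=M_2(\xi+)$. -/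

import Mathlib

/-- The open interval `(a, b)` of real numbers, with possibly infinite end points. -/
def openInterval (a b : EReal) : Set ℝ := {x : ℝ | a < (x : EReal) ∧ (x : EReal) < b}

/-- `f` is `n`-Wright-convex on the interval `I`: all differences `Δ_{h_{n+1}} ⋯ Δ_{h_1} f (x)` with
positive steps are non-negative, where `Δ_h f (x) = f (x + h) - f x`. The points at which `f` is
evaluated all lie between `x` and `x + h_1 + ⋯ + h_{n+1}`, hence in `I`. -/
def WrightConvexOn (n : ℕ) (I : Set ℝ) (f : ℝ → ℝ) : Prop :=
  ∀ hs : List ℝ, hs.length = n + 1 → (∀ h ∈ hs, 0 < h) →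
    ∀ x ∈ I, x + hs.sum ∈ I → 0 ≤ (hs.foldr (fun h g => fwdDiff h g) f) x

/-- `P` is a (possibly discontinuous) polynomial function of degree at most `n`: it solves the
Fréchet equation `(Δ_h)^{n+1} P (x) = 0` for all real `h` and `x`. -/
def IsPolynomialFunction (n : ℕ) (P : ℝ → ℝ) : Prop :=
  ∀ h x : ℝ, ((fwdDiff h)^[n + 1] P) x = 0

/-- `m`-times monotone non-decreasing functions on the open interval `I`. For `m ≥ 2` the
derivatives up to order `m - 2` exist and are non-negative, non-decreasing and convex on `I` (the
last of them is then automatically continuous, as a convex function on an open interval); for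
`m = 1` the function is non-negative and non-decreasing. -/
def MultiplyMonotoneOn (m : ℕ) (I : Set ℝ) (f : ℝ → ℝ) : Prop :=
  match m with
  | m + 2 => ContDiffOn ℝ m f I ∧ ∀ k ≤ m,
      (∀ x ∈ I, 0 ≤ iteratedDeriv k f x) ∧
      MonotoneOn (iteratedDeriv k f) I ∧ ConvexOn ℝ I (iteratedDeriv k f)
  | _ => (∀ x ∈ I, 0 ≤ f x) ∧ MonotoneOn f I

/-- `m`-times monotone non-increasing functions on the open interval `I`. For `m ≥ 2` the functions
`(-1)^k f^{(k)}`, `k ≤ m - 2`, exist and are non-negative, non-increasing and convex on `I`; for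
`m = 1` the function is non-negative and non-increasing. -/
def MultiplyAntitoneOn (m : ℕ) (I : Set ℝ) (f : ℝ → ℝ) : Prop :=
  match m with
  | m + 2 => ContDiffOn ℝ m f I ∧ ∀ k ≤ m,
      (∀ x ∈ I, 0 ≤ (-1) ^ k * iteratedDeriv k f x) ∧
      AntitoneOn (fun x => (-1) ^ k * iteratedDeriv k f x) I ∧
      ConvexOn ℝ I (fun x => (-1) ^ k * iteratedDeriv k f x)
  | _ => (∀ x ∈ I, 0 ≤ f x) ∧ AntitoneOn f I

/-- `f = M₁ + M₂ + Q + P` on `(a, b)`, where `M₁` lives on `(a, ξ)`, `M₂` lives on `(ξ, b)` (each is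
continued by `0` to the other side of `ξ`; the values at `ξ` itself are left to the smoothness
condition on `M₁ + M₂`), `Q` is a polynomial and `P` a polynomial function of degree at most `n`.
For `n = 1` the condition `glue` says that `M₁ + M₂` is continuous on `(a, b)`. -/
structure IsWrightDecomposition (n : ℕ) (a b ξ : EReal) (f M₁ M₂ : ℝ → ℝ) (Q : Polynomial ℝ)
    (P : ℝ → ℝ) : Prop where
  left_le : a ≤ ξ
  le_right : ξ ≤ b
  monotone_left : MultiplyAntitoneOn (n + 1) (openInterval a ξ) (fun x => (-1) ^ (n + 1) * M₁ x)
  zero_right : ∀ x ∈ openInterval ξ b, M₁ x = 0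
  monotone_right : MultiplyMonotoneOn (n + 1) (openInterval ξ b) M₂
  zero_left : ∀ x ∈ openInterval a ξ, M₂ x = 0
  glue : ContDiffOn ℝ ((n - 1 : ℕ) : WithTop ℕ∞) (fun x => M₁ x + M₂ x) (openInterval a b)
  degree_le : Q.natDegree ≤ n
  polynomialFunction : IsPolynomialFunction n P
  eq_sum : ∀ x ∈ openInterval a b, f x = M₁ x + M₂ x + Q.eval x + P x

/-- The normalization of a decomposition: the sign of the coefficient `c_n` of `x ^ n / n!` in `Q`
(equivalently, of the coefficient of `x ^ n`), and `M₁ (ξ-) = M₂ (ξ+)`. If `M₁` is not zero on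
`(a, ξ)` and `M₂` is not zero on `(ξ, b)` then `ξ` is a real number. -/
structure IsNormalized (n : ℕ) (a b ξ : EReal) (M₁ M₂ : ℝ → ℝ) (Q : Polynomial ℝ) : Prop where
  coeff_nonneg : (∀ x ∈ openInterval a ξ, M₁ x = 0) → (∃ x ∈ openInterval ξ b, M₂ x ≠ 0) →
    0 ≤ Q.coeff n
  coeff_nonpos : (∀ x ∈ openInterval ξ b, M₂ x = 0) → (∃ x ∈ openInterval a ξ, M₁ x ≠ 0) →
    Q.coeff n ≤ 0
  coeff_zero : (∃ x ∈ openInterval a ξ, M₁ x ≠ 0) → (∃ x ∈ openInterval ξ b, M₂ x ≠ 0) →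
    Q.coeff n = 0 ∧ ∃ L : ℝ, Filter.Tendsto M₁ (nhdsWithin ξ.toReal (Set.Iio ξ.toReal)) (nhds L) ∧
      Filter.Tendsto M₂ (nhdsWithin ξ.toReal (Set.Ioi ξ.toReal)) (nhds L)

/-! Sufficiency. The derivative of order `n - 1` of `M₁ + M₂` is continuous, convex decreasing
before `ξ` and convex increasing after it, hence convex on the whole interval
(`convexOn_of_antitoneOn_of_monotoneOn`). A convex function is 1-Wright-convex, and each integration
raises the order by one (`WrightConvexOn.of_hasDerivAt`). Differences of order `n + 1` kill `Q` and
`P`, also with unequal steps, by polarization.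

Necessity. No regularity of `f` is available, so a substitute for its `n`-th derivative is built
from rational steps. Two rational steps have a common refinement, which makes the slopes `Δ_q^n f
(x) / q^n` comparable (`WrightConvexOn.slope_le_slope`); their infimum `D x` is therefore finite and
monotone in `x`. Let `R` be the `n`-fold primitive of `D - D ξ` based at `ξ`, and `g = f - R`. The
slopes of `f`, and those of `R` raised by `D ξ`, both lie between `D x` and `D (x + n q)`. Cutting a
step into `N` parts makes these errors telescope to `O(1/N)`, so `Δ_q^n g = q^n D ξ` for rational `q
> 0` (`iterate_fwdDiff_eq_of_abs_le`).

Thus the differences of `g` of order `n + 1` vanish for rational steps. For real steps they are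
bounded below by those of `-R`, which is continuous; this one-sided bound and rational periodicity
force them to vanish (`multiDiff_eq_zero_of_ge_continuous`). So `g` solves the Fréchet equation on
the interval, and it extends to the line along the rays from `ξ`
(`exists_isPolynomialFunction_extension`). Cutting `R` at `ξ` gives `M₁` and `M₂`, whose signs
follow by integrating `D - D ξ` repeatedly from its zero `ξ`. -/

/-! ### Calculus of iterated differences -/

/-- The iterated difference `Δ_{h_1} ⋯ Δ_{h_m} F` for a list of steps. -/
def multiDiff (hs : List ℝ) (F : ℝ → ℝ) : ℝ → ℝ := hs.foldr (fun h g => fwdDiff h g) F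

@[simp] theorem multiDiff_nil (F : ℝ → ℝ) : multiDiff [] F = F := rfl

@[simp] theorem multiDiff_cons (h : ℝ) (hs : List ℝ) (F : ℝ → ℝ) :
    multiDiff (h :: hs) F = fwdDiff h (multiDiff hs F) := rfl

theorem multiDiff_append (hs ks : List ℝ) (F : ℝ → ℝ) :
    multiDiff (hs ++ ks) F = multiDiff hs (multiDiff ks F) := by
  simp [multiDiff, List.foldr_append]

theorem fwdDiff_left_comm (h k : ℝ) (F : ℝ → ℝ) :
    fwdDiff h (fwdDiff k F) = fwdDiff k (fwdDiff h F) := by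
  funext x
  simp only [fwdDiff, add_right_comm x h k]
  ring

theorem multiDiff_perm {hs ks : List ℝ} (p : hs.Perm ks) (F : ℝ → ℝ) :
    multiDiff hs F = multiDiff ks F := by
  have : LeftCommutative (fun (h : ℝ) (g : ℝ → ℝ) => fwdDiff h g) := ⟨fwdDiff_left_comm⟩
  exact p.foldr_eq F

theorem multiDiff_replicate (m : ℕ) (h : ℝ) (F : ℝ → ℝ) :
    multiDiff (List.replicate m h) F = (fwdDiff h)^[m] F := by
  induction m with
  | zero => rfl
  | succ m ih => rw [List.replicate_succ, multiDiff_cons, ih, Function.iterate_succ_apply']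

theorem multiDiff_add (hs : List ℝ) (F G : ℝ → ℝ) (x : ℝ) :
    multiDiff hs (fun y => F y + G y) x = multiDiff hs F x + multiDiff hs G x := by
  induction hs generalizing x with
  | nil => rfl
  | cons h hs ih => simp only [multiDiff_cons, fwdDiff, ih]; ring

theorem multiDiff_sub (hs : List ℝ) (F G : ℝ → ℝ) (x : ℝ) :
    multiDiff hs (fun y => F y - G y) x = multiDiff hs F x - multiDiff hs G x := by
  induction hs generalizing x with
  | nil => rfl
  | cons h hs ih => simp only [multiDiff_cons, fwdDiff, ih]; ring

theorem multiDiff_fwdDiff (hs : List ℝ) (h : ℝ) (F : ℝ → ℝ) :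
    multiDiff hs (fwdDiff h F) = fwdDiff h (multiDiff hs F) := by
  have := multiDiff_perm (List.perm_append_comm (l₁ := hs) (l₂ := [h])) F
  rwa [multiDiff_append, multiDiff_append] at this

theorem iterate_fwdDiff_comm (i j : ℕ) (h k : ℝ) (F : ℝ → ℝ) :
    (fwdDiff h)^[i] ((fwdDiff k)^[j] F) = (fwdDiff k)^[j] ((fwdDiff h)^[i] F) := by
  rw [← multiDiff_replicate, ← multiDiff_replicate, ← multiDiff_replicate,
    ← multiDiff_replicate, ← multiDiff_append, ← multiDiff_append]
  exact multiDiff_perm List.perm_append_comm F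

theorem sum_nonneg_of_pos {hs : List ℝ} (hpos : ∀ h ∈ hs, 0 < h) : 0 ≤ hs.sum :=
  List.sum_nonneg fun h hh => (hpos h hh).le

theorem Set.OrdConnected.mem_of_le {I : Set ℝ} (hI : I.OrdConnected) {x y z : ℝ} (hx : x ∈ I)
    (hz : z ∈ I) (hxy : x ≤ y) (hyz : y ≤ z) : y ∈ I := hI.out hx hz ⟨hxy, hyz⟩

theorem multiDiff_congr {I : Set ℝ} (hI : I.OrdConnected) {F G : ℝ → ℝ} (hFG : Set.EqOn F G I)
    {hs : List ℝ} (hpos : ∀ h ∈ hs, 0 < h) {x : ℝ} (hx : x ∈ I) (hxs : x + hs.sum ∈ I) :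
    multiDiff hs F x = multiDiff hs G x := by
  induction hs generalizing x with
  | nil => exact hFG hx
  | cons h hs ih =>
    have hp : ∀ k ∈ hs, 0 < k := fun k hk => hpos k (by simp [hk])
    have h0 : 0 < h := hpos h (by simp)
    have hs0 := sum_nonneg_of_pos hp
    rw [List.sum_cons] at hxs
    simp only [multiDiff_cons, fwdDiff]
    rw [ih hp hx (hI.mem_of_le hx hxs (by linarith) (by linarith)),
      ih hp (hI.mem_of_le hx hxs (by linarith) (by linarith)) (by rwa [add_assoc])]

theorem continuousAt_multiDiff {I : Set ℝ} (hI : I.OrdConnected) (hIo : IsOpen I) {F : ℝ → ℝ}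
    (hF : ContinuousOn F I) {hs : List ℝ} (hpos : ∀ h ∈ hs, 0 < h) {x : ℝ} (hx : x ∈ I)
    (hxs : x + hs.sum ∈ I) : ContinuousAt (multiDiff hs F) x := by
  induction hs generalizing x with
  | nil => exact hF.continuousAt (hIo.mem_nhds hx)
  | cons h hs ih =>
    have hp : ∀ k ∈ hs, 0 < k := fun k hk => hpos k (by simp [hk])
    have h0 : 0 < h := hpos h (by simp)
    have hs0 := sum_nonneg_of_pos hp
    rw [List.sum_cons] at hxs
    have h1 := ih hp hx (hI.mem_of_le hx hxs (by linarith) (by linarith))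
    have h2 := ih hp (x := x + h) (hI.mem_of_le hx hxs (by linarith) (by linarith))
      (by rwa [add_assoc])
    rw [multiDiff_cons]
    have h3 : ContinuousAt (fun y => multiDiff hs F (y + h)) x :=
      ContinuousAt.comp_of_eq (g := multiDiff hs F) (f := fun y => y + h) h2 (by fun_prop) rfl
    exact h3.sub h1

/-- Telescoping. All later passages from a coarse step to a finer one rest on this. -/
theorem fwdDiff_natCast_mul (N : ℕ) (h : ℝ) (F : ℝ → ℝ) (x : ℝ) :
    fwdDiff (N * h) F x = ∑ i ∈ Finset.range N, fwdDiff h F (x + i * h) := by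
  have := Finset.sum_range_sub (fun i : ℕ => F (x + i * h)) N
  simp only [fwdDiff, Nat.cast_add, Nat.cast_one, Nat.cast_zero, zero_mul, add_zero] at this ⊢
  rw [← this]
  exact Finset.sum_congr rfl fun i _ => by rw [add_assoc x, add_one_mul]

theorem iterate_fwdDiff_comp_affine (m : ℕ) (r h x : ℝ) (F : ℝ → ℝ) (s : ℝ) :
    (fwdDiff r)^[m] (fun t => F (x + t * h)) s = (fwdDiff (r * h))^[m] F (x + s * h) := by
  induction m generalizing s with
  | zero => rfl
  | succ m ih =>
    rw [Function.iterate_succ_apply', Function.iterate_succ_apply']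
    simp only [fwdDiff, ih, add_mul, add_assoc]

theorem Polynomial.iterate_fwdDiff_eq_zero {Q : Polynomial ℝ} {n : ℕ} (hQ : Q.natDegree ≤ n)
    (h x : ℝ) : (fwdDiff h)^[n + 1] (fun t => Q.eval t) x = 0 := by
  have h1 := iterate_fwdDiff_comp_affine (n + 1) 1 h x (fun t => Q.eval t) 0
  rw [zero_mul, add_zero, one_mul] at h1
  rw [← h1]
  have h2 : (fun t => Q.eval (x + t * h)) =
      (Q.comp (Polynomial.C x + Polynomial.X * Polynomial.C h)).eval := by
    funext t
    rw [Polynomial.eval_comp, Polynomial.eval_add, Polynomial.eval_mul, Polynomial.eval_C,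
      Polynomial.eval_C, Polynomial.eval_X]
  rw [h2, Polynomial.fwdDiff_iter_eq_zero_of_degree_lt]
  · rfl
  · refine Nat.lt_succ_of_le ((Polynomial.natDegree_comp_le).trans ?_)
    have h3 : (Polynomial.C x + Polynomial.X * Polynomial.C h).natDegree ≤ 1 := by
      compute_degree
    exact (Nat.mul_le_mul hQ h3).trans_eq (mul_one n)

theorem isPolynomialFunction_polynomial {Q : Polynomial ℝ} {n : ℕ} (hQ : Q.natDegree ≤ n) :
    IsPolynomialFunction n (fun t => Q.eval t) :=
  fun h x => Polynomial.iterate_fwdDiff_eq_zero hQ h x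

/-! ### Polarization: from equal steps to arbitrary steps -/

/-- The shift operator `F ↦ F (· + a)` as a linear map. -/
def shiftEnd (a : ℝ) : Module.End ℝ (ℝ → ℝ) where
  toFun F x := F (x + a)
  map_add' _ _ := rfl
  map_smul' _ _ := rfl

/-- The action of the group algebra of `ℝ` on functions by shifts. -/
noncomputable def shiftAction : AddMonoidAlgebra ℝ ℝ →ₐ[ℝ] Module.End ℝ (ℝ → ℝ) :=
  AddMonoidAlgebra.lift ℝ (Module.End ℝ (ℝ → ℝ)) ℝ
    { toFun := fun a => shiftEnd a.toAdd
      map_one' := by ext F x; simp [shiftEnd]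
      map_mul' := fun a b => by ext F x; simp [shiftEnd, add_assoc] }

theorem shiftAction_single (a : ℝ) :
    shiftAction (AddMonoidAlgebra.single a 1) = shiftEnd a := by
  simp [shiftAction]

theorem shiftAction_single_sub_one (a : ℝ) (F : ℝ → ℝ) :
    shiftAction (AddMonoidAlgebra.single a 1 - 1) F = fwdDiff a F := by
  rw [map_sub, shiftAction_single, map_one]
  rfl

theorem shiftAction_list_prod (hs : List ℝ) (F : ℝ → ℝ) :
    shiftAction (hs.map fun h => AddMonoidAlgebra.single h 1 - 1).prod F = multiDiff hs F := by
  induction hs with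
  | nil => simp
  | cons h hs ih =>
    rw [List.map_cons, List.prod_cons, map_mul, Module.End.mul_apply, ih,
      shiftAction_single_sub_one, multiDiff_cons]

theorem shiftAction_pow (m : ℕ) (a : ℝ) (F : ℝ → ℝ) :
    shiftAction ((AddMonoidAlgebra.single a 1 - 1) ^ m) F = (fwdDiff a)^[m] F := by
  have := shiftAction_list_prod (List.replicate m a) F
  rwa [List.map_replicate, List.prod_replicate, multiDiff_replicate] at this

/-- Djoković's polarization identity in the group algebra. -/
theorem prod_single_sub_one_eq (m : ℕ) (h : ℕ → ℝ) :
    ∏ j ∈ Finset.range m, (AddMonoidAlgebra.single (h j) (1 : ℝ) - 1) =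
      ∑ S ∈ (Finset.range m).powerset,
        (-1) ^ (Finset.range m \ S).card * AddMonoidAlgebra.single (∑ j ∈ S, h j) (1 : ℝ) *
          (-1) ^ m * (AddMonoidAlgebra.single (-∑ j ∈ S, h j / (j + 1)) (1 : ℝ) - 1) ^ m := by
  -- The divisor `j + 1` is chosen so that for `k ≥ 1` the factor with `j = k - 1` has exponent zero
  -- and vanishes; only `k = 0` survives.
  have key : ∏ j ∈ Finset.range m, (AddMonoidAlgebra.single (h j) (1 : ℝ) - 1) =
      ∑ k ∈ Finset.range (m + 1), (-1) ^ k * (m.choose k : AddMonoidAlgebra ℝ ℝ) *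
        ∏ j ∈ Finset.range m,
          (AddMonoidAlgebra.single (h j + k * -(h j / (j + 1))) (1 : ℝ) - 1) := by
    rw [Finset.sum_range_succ', Finset.sum_eq_zero, zero_add]
    · simp
    · intro k hk
      rw [Finset.prod_eq_zero hk, mul_zero]
      have : h k + ((k + 1 : ℕ) : ℝ) * -(h k / (k + 1)) = 0 := by
        have : (k : ℝ) + 1 ≠ 0 := by positivity
        push_cast
        field_simp
        ring
      rw [this, ← AddMonoidAlgebra.one_def, sub_self]
  have hprod : ∀ (S : Finset ℕ) (u : ℕ → ℝ),
      ∏ j ∈ S, (AddMonoidAlgebra.single (u j) (1 : ℝ)) =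
        AddMonoidAlgebra.single (∑ j ∈ S, u j) 1 := by
    intro S u
    induction S using Finset.induction_on with
    | empty => simp [AddMonoidAlgebra.one_def]
    | insert a S ha ih =>
      rw [Finset.prod_insert ha, Finset.sum_insert ha, ih, AddMonoidAlgebra.single_mul_single,
        one_mul]
  have hpow : ∀ (u : ℝ) (k : ℕ), AddMonoidAlgebra.single (k * u) (1 : ℝ) =
      AddMonoidAlgebra.single u (1 : ℝ) ^ k := by
    intro u k
    rw [AddMonoidAlgebra.single_pow, one_pow, nsmul_eq_mul]
  rw [key]
  -- Expand the product over subsets `S` and exchange the sums: for fixed `S` the sum over `k` is a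
  -- binomial expansion.
  simp_rw [sub_eq_add_neg, Finset.prod_add, Finset.mul_sum]
  rw [Finset.sum_comm]
  refine Finset.sum_congr rfl fun S _ => ?_
  rw [mul_assoc _ ((-1) ^ m), ← mul_pow, neg_one_mul, neg_add, neg_neg,
    add_comm (-_) (1 : AddMonoidAlgebra ℝ ℝ), add_comm (1 : AddMonoidAlgebra ℝ ℝ), add_pow, Finset.mul_sum]
  refine Finset.sum_congr rfl fun k _ => ?_
  rw [hprod, Finset.sum_add_distrib, ← Finset.mul_sum, Finset.sum_neg_distrib, Finset.prod_const,
    ← mul_one (1 : ℝ), ← AddMonoidAlgebra.single_mul_single, hpow, mul_one (1 : ℝ), one_pow,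
    neg_pow (AddMonoidAlgebra.single _ _) k]
  ring

/-- Every term of the polarization identity contains the `(n + 1)`-st power of a single difference
operator, which kills `P`. -/
theorem IsPolynomialFunction.multiDiff_eq_zero {n : ℕ} {P : ℝ → ℝ}
    (hP : IsPolynomialFunction n P) {hs : List ℝ} (hl : hs.length = n + 1) (x : ℝ) :
    multiDiff hs P x = 0 := by
  -- The default value `0` is never read, as `j` stays below the length.
  have hlist : (hs.map fun h => AddMonoidAlgebra.single h (1 : ℝ) - 1).prod =
      ∏ j ∈ Finset.range (n + 1), (AddMonoidAlgebra.single (hs.getD j 0) (1 : ℝ) - 1) := by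
    rw [← hl, Finset.prod_range, ← Fin.prod_univ_getElem]
    refine Fintype.prod_equiv (finCongr (List.length_map _)) _ _ fun i => ?_
    have hi : i.1 < hs.length := by simpa using i.2
    simp [List.getElem?_eq_getElem hi]
  rw [← shiftAction_list_prod, hlist, prod_single_sub_one_eq, map_sum, LinearMap.sum_apply,
    Finset.sum_apply]
  refine Finset.sum_eq_zero fun S _ => ?_
  rw [map_mul, Module.End.mul_apply, shiftAction_pow,
    show (fwdDiff _)^[n + 1] P = 0 from funext fun y => hP _ y, map_zero, Pi.zero_apply]

/-! ### Wright convexity from a convex derivative -/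

theorem isOpen_openInterval (a b : EReal) : IsOpen (openInterval a b) :=
  (isOpen_Ioi.preimage continuous_coe_real_ereal).inter
    (isOpen_Iio.preimage continuous_coe_real_ereal)

theorem ordConnected_openInterval (a b : EReal) : (openInterval a b).OrdConnected :=
  ⟨fun _ hx _ hy _ hz => ⟨hx.1.trans_le (EReal.coe_le_coe_iff.2 hz.1),
    (EReal.coe_le_coe_iff.2 hz.2).trans_lt hy.2⟩⟩

theorem hasDerivAt_multiDiff {I : Set ℝ} (hI : I.OrdConnected) {F F' : ℝ → ℝ}
    (hF : ∀ x ∈ I, HasDerivAt F (F' x) x) {hs : List ℝ} (hpos : ∀ h ∈ hs, 0 < h) {x : ℝ}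
    (hx : x ∈ I) (hxs : x + hs.sum ∈ I) :
    HasDerivAt (multiDiff hs F) (multiDiff hs F' x) x := by
  induction hs generalizing x with
  | nil => exact hF x hx
  | cons h hs ih =>
    have hp : ∀ k ∈ hs, 0 < k := fun k hk => hpos k (by simp [hk])
    have h0 : 0 < h := hpos h (by simp)
    have hs0 := sum_nonneg_of_pos hp
    rw [List.sum_cons] at hxs
    have h1 := ih hp hx (hI.mem_of_le hx hxs (by linarith) (by linarith))
    have h2 := ih hp (x := x + h) (hI.mem_of_le hx hxs (by linarith) (by linarith))
      (by rwa [add_assoc])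
    exact (h2.comp_add_const x h).sub h1

/-- Differences commute with differentiation, so a difference of `F` of order `m + 1` has
non-negative derivative; it increases, and one more difference is non-negative. -/
theorem WrightConvexOn.of_hasDerivAt {I : Set ℝ} (hI : I.OrdConnected) {m : ℕ} {F F' : ℝ → ℝ}
    (hF : ∀ x ∈ I, HasDerivAt F (F' x) x) (hW : WrightConvexOn m I F') :
    WrightConvexOn (m + 1) I F := by
  intro hs hl hpos x hx hxs
  obtain - | ⟨h, hs⟩ := hs
  · simp at hl
  have hp : ∀ k ∈ hs, 0 < k := fun k hk => hpos k (by simp [hk])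
  have h0 : 0 < h := hpos h (by simp)
  have hs0 := sum_nonneg_of_pos hp
  rw [List.sum_cons] at hxs
  have hmem : ∀ y ∈ Set.Icc x (x + h), y ∈ I ∧ y + hs.sum ∈ I := fun y hy =>
    ⟨hI.mem_of_le hx hxs hy.1 (by linarith [hy.2]),
      hI.mem_of_le hx hxs (by linarith [hy.1]) (by linarith [hy.2])⟩
  have hd : ∀ y ∈ Set.Icc x (x + h), HasDerivAt (multiDiff hs F) (multiDiff hs F' y) y :=
    fun y hy => hasDerivAt_multiDiff hI hF hp (hmem y hy).1 (hmem y hy).2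
  have hmono : MonotoneOn (multiDiff hs F) (Set.Icc x (x + h)) := by
    refine monotoneOn_of_deriv_nonneg (convex_Icc _ _)
      (fun y hy => (hd y hy).continuousAt.continuousWithinAt)
      (fun y hy => (hd y (interior_subset hy)).differentiableAt.differentiableWithinAt)
      fun y hy => ?_
    have hy' := interior_subset hy
    rw [(hd y hy').deriv]
    exact hW hs (by simpa using hl) hp y (hmem y hy').1 (hmem y hy').2
  exact sub_nonneg.2 (hmono (Set.left_mem_Icc.2 (by linarith)) (Set.right_mem_Icc.2 (by linarith))
    (by linarith))

/-- The points `x + h` and `x + k` are convex combinations of `x` and `x + h + k` with interchanged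
weights; add the two inequalities. -/
theorem ConvexOn.wrightConvexOn {I : Set ℝ} {φ : ℝ → ℝ} (hφ : ConvexOn ℝ I φ) :
    WrightConvexOn 1 I φ := by
  intro hs hl hpos x hx hxs
  obtain ⟨h, k, rfl⟩ := List.length_eq_two.1 hl
  have h0 : 0 < h := hpos h (by simp)
  have k0 : 0 < k := hpos k (by simp)
  have hhk : h + k ≠ 0 := by positivity
  have hsum : x + [h, k].sum = x + h + k := by simp [add_assoc]
  rw [hsum] at hxs
  have e1 := hφ.2 hx hxs (show 0 ≤ k / (h + k) by positivity)
    (show 0 ≤ h / (h + k) by positivity)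
    (by field_simp; ring)
  have e2 := hφ.2 hx hxs (show 0 ≤ h / (h + k) by positivity)
    (show 0 ≤ k / (h + k) by positivity)
    (by field_simp)
  simp only [smul_eq_mul] at e1 e2
  rw [show k / (h + k) * x + h / (h + k) * (x + h + k) = x + h by field_simp; ring] at e1
  rw [show h / (h + k) * x + k / (h + k) * (x + h + k) = x + k by field_simp; ring] at e2
  have e3 : k / (h + k) = 1 - h / (h + k) := by field_simp; ring
  rw [e3] at e1 e2
  simp only [List.foldr, fwdDiff]
  linarith

theorem hasDerivAt_iteratedDeriv {I : Set ℝ} (hIo : IsOpen I) {m j : ℕ} {F : ℝ → ℝ}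
    (hF : ContDiffOn ℝ m F I) (hj : j < m) {x : ℝ} (hx : x ∈ I) :
    HasDerivAt (iteratedDeriv j F) (iteratedDeriv (j + 1) F x) x := by
  have h1 := hF.differentiableOn_iteratedDerivWithin (m := j) (by exact_mod_cast hj)
    hIo.uniqueDiffOn
  have h2 := (h1.congr fun y hy => (iteratedDerivWithin_of_isOpen hIo hy).symm).differentiableAt
    (hIo.mem_nhds hx)
  rw [iteratedDeriv_succ]
  exact h2.hasDerivAt

theorem continuousOn_iteratedDeriv {I : Set ℝ} (hIo : IsOpen I) {m : ℕ} {F : ℝ → ℝ}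
    (hF : ContDiffOn ℝ m F I) : ContinuousOn (iteratedDeriv m F) I :=
  (hF.continuousOn_iteratedDerivWithin le_rfl hIo.uniqueDiffOn).congr fun _ hy =>
    (iteratedDerivWithin_of_isOpen hIo hy).symm

theorem WrightConvexOn.of_convexOn_iteratedDeriv {I : Set ℝ} (hI : I.OrdConnected)
    (hIo : IsOpen I) {m : ℕ} {F : ℝ → ℝ} (hF : ContDiffOn ℝ m F I)
    (hconv : ConvexOn ℝ I (iteratedDeriv m F)) : WrightConvexOn (m + 1) I F := by
  have key : ∀ i j, i + j = m → WrightConvexOn (i + 1) I (iteratedDeriv j F) := by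
    intro i
    induction i with
    | zero =>
      intro j hj
      rw [zero_add] at hj
      exact hj ▸ hconv.wrightConvexOn
    | succ i ih =>
      intro j hj
      exact WrightConvexOn.of_hasDerivAt hI
        (fun x hx => hasDerivAt_iteratedDeriv hIo hF (by omega) hx) (ih (j + 1) (by omega))
  simpa using key m 0 (add_zero m)

/-! ### Gluing convex pieces at `ξ` -/

section Closure

variable {s S : Set ℝ} {p : ℝ} {φ : ℝ → ℝ}

/-- Contracting `S` towards `p` moves it into `s`. As the contraction tends to the identity,
inequalities known on `s` pass to the limit on `S`. -/
theorem tendsto_contract (hφ : ContinuousOn φ S)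
    (hsS : s ⊆ S) (hp : ∀ x ∈ S, ∀ t ∈ Set.Ioc (0 : ℝ) 1, x + t * (p - x) ∈ s) {x : ℝ}
    (hx : x ∈ S) :
    Filter.Tendsto (fun t => φ (x + t * (p - x))) (nhdsWithin 0 (Set.Ioc 0 1)) (nhds (φ x)) := by
  refine (hφ x hx).tendsto.comp (tendsto_nhdsWithin_iff.2 ⟨?_, ?_⟩)
  · have : Continuous fun t : ℝ => x + t * (p - x) := by fun_prop
    simpa using (this.tendsto 0).mono_left nhdsWithin_le_nhds
  · filter_upwards [self_mem_nhdsWithin] with t ht using hsS (hp x hx t ht)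

theorem neBot_nhdsWithin_Ioc : (nhdsWithin (0 : ℝ) (Set.Ioc 0 1)).NeBot := by
  rw [nhdsWithin_Ioc_eq_nhdsGT one_pos]
  infer_instance

theorem ConvexOn.extend_of_continuousOn (hφ : ContinuousOn φ S) (hsS : s ⊆ S)
    (hp : ∀ x ∈ S, ∀ t ∈ Set.Ioc (0 : ℝ) 1, x + t * (p - x) ∈ s) (hS : Convex ℝ S)
    (hc : ConvexOn ℝ s φ) : ConvexOn ℝ S φ := by
  refine ⟨hS, fun x hx y hy a b ha hb hab => ?_⟩
  have := neBot_nhdsWithin_Ioc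
  simp only [smul_eq_mul]
  refine le_of_tendsto_of_tendsto (tendsto_contract hφ hsS hp (hS hx hy ha hb hab))
    (((tendsto_contract hφ hsS hp hx).const_mul a).add
      ((tendsto_contract hφ hsS hp hy).const_mul b)) ?_
  filter_upwards [self_mem_nhdsWithin] with t ht
  have h := hc.2 (hp x hx t ht) (hp y hy t ht) ha hb hab
  simp only [smul_eq_mul] at h ⊢
  convert h using 2
  linear_combination (-(t * p)) * hab

theorem MonotoneOn.extend_of_continuousOn (hφ : ContinuousOn φ S) (hsS : s ⊆ S)
    (hp : ∀ x ∈ S, ∀ t ∈ Set.Ioc (0 : ℝ) 1, x + t * (p - x) ∈ s)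
    (hc : MonotoneOn φ s) : MonotoneOn φ S := by
  intro x hx y hy hxy
  have := neBot_nhdsWithin_Ioc
  refine le_of_tendsto_of_tendsto (tendsto_contract hφ hsS hp hx)
    (tendsto_contract hφ hsS hp hy) ?_
  filter_upwards [self_mem_nhdsWithin] with t ht
  exact hc (hp x hx t ht) (hp y hy t ht) (by nlinarith [ht.2])

end Closure

/-- By continuity both halves may include `ξ`. Then `φ x = φ (min x ξ) + φ (max x ξ) - φ ξ`, where
the first term is a decreasing convex function of a concave one, and the second an increasing convex
function of a convex one. -/
theorem convexOn_of_antitoneOn_of_monotoneOn {I : Set ℝ} (hI : I.OrdConnected) (hIo : IsOpen I)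
    {φ : ℝ → ℝ} (hφ : ContinuousOn φ I) {ξ : ℝ} (hξ : ξ ∈ I)
    (hl : ConvexOn ℝ (I ∩ Set.Iio ξ) φ) (hl' : AntitoneOn φ (I ∩ Set.Iio ξ))
    (hr : ConvexOn ℝ (I ∩ Set.Ioi ξ) φ) (hr' : MonotoneOn φ (I ∩ Set.Ioi ξ)) :
    ConvexOn ℝ I φ := by
  have hconv : Convex ℝ I := hI.convex
  obtain ⟨ε, hε, hball⟩ := Metric.isOpen_iff.1 hIo ξ hξ
  have hpl : ξ - ε / 2 ∈ I := hball (by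
    rw [Metric.mem_ball, Real.dist_eq, abs_lt]; constructor <;> linarith)
  have hpr : ξ + ε / 2 ∈ I := hball (by
    rw [Metric.mem_ball, Real.dist_eq, abs_lt]; constructor <;> linarith)
  have cl : ∀ x ∈ I ∩ Set.Iic ξ, ∀ t ∈ Set.Ioc (0 : ℝ) 1,
      x + t * (ξ - ε / 2 - x) ∈ I ∩ Set.Iio ξ := by
    rintro x ⟨hx, hxξ⟩ t ⟨ht0, ht1⟩
    refine ⟨?_, ?_⟩
    · have := hconv hx hpl (sub_nonneg.2 ht1) ht0.le (by ring)
      simp only [smul_eq_mul] at this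
      convert this using 1; ring
    · simp only [Set.mem_Iio, Set.mem_Iic] at *
      nlinarith [mul_pos ht0 hε]
  have cr : ∀ x ∈ I ∩ Set.Ici ξ, ∀ t ∈ Set.Ioc (0 : ℝ) 1,
      x + t * (ξ + ε / 2 - x) ∈ I ∩ Set.Ioi ξ := by
    rintro x ⟨hx, hxξ⟩ t ⟨ht0, ht1⟩
    refine ⟨?_, ?_⟩
    · have := hconv hx hpr (sub_nonneg.2 ht1) ht0.le (by ring)
      simp only [smul_eq_mul] at this
      convert this using 1; ring
    · simp only [Set.mem_Ioi, Set.mem_Ici] at *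
      nlinarith [mul_pos ht0 hε]
  have sl : I ∩ Set.Iio ξ ⊆ I ∩ Set.Iic ξ :=
    Set.inter_subset_inter_right _ Set.Iio_subset_Iic_self
  have sr : I ∩ Set.Ioi ξ ⊆ I ∩ Set.Ici ξ :=
    Set.inter_subset_inter_right _ Set.Ioi_subset_Ici_self
  have hL := hl.extend_of_continuousOn (hφ.mono Set.inter_subset_left) sl cl
    (hconv.inter (convex_Iic ξ))
  have hR := hr.extend_of_continuousOn (hφ.mono Set.inter_subset_left) sr cr
    (hconv.inter (convex_Ici ξ))
  have hL' : AntitoneOn φ (I ∩ Set.Iic ξ) := by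
    have := hl'.neg.extend_of_continuousOn (hφ.mono Set.inter_subset_left).neg sl cl
    simpa using this.neg
  have hR' := hr'.extend_of_continuousOn (hφ.mono Set.inter_subset_left) sr cr
  have im : (fun x => min x ξ) '' I = I ∩ Set.Iic ξ := by
    ext y
    constructor
    · rintro ⟨x, hx, rfl⟩
      refine ⟨?_, min_le_right x ξ⟩
      dsimp only
      rcases min_choice x ξ with h | h <;> rw [h] <;> assumption
    · rintro ⟨hy, hyξ⟩
      exact ⟨y, hy, min_eq_left hyξ⟩
  have iM : (fun x => max x ξ) '' I = I ∩ Set.Ici ξ := by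
    ext y
    constructor
    · rintro ⟨x, hx, rfl⟩
      refine ⟨?_, le_max_right x ξ⟩
      dsimp only
      rcases max_choice x ξ with h | h <;> rw [h] <;> assumption
    · rintro ⟨hy, hyξ⟩
      exact ⟨y, hy, max_eq_left hyξ⟩
  have A : ConvexOn ℝ I (φ ∘ fun x => min x ξ) := by
    refine ConvexOn.comp_concaveOn (im ▸ hL) ?_ (im ▸ hL')
    exact (concaveOn_id hconv).inf (concaveOn_const ξ hconv)
  have B : ConvexOn ℝ I (φ ∘ fun x => max x ξ) := by
    refine ConvexOn.comp (iM ▸ hR) ?_ (iM ▸ hR')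
    exact (convexOn_id hconv).sup (convexOn_const ξ hconv)
  refine ((A.add B).add_const (-φ ξ)).congr fun x _ => ?_
  simp only [Pi.add_apply, Function.comp_apply]
  rcases le_total x ξ with h | h
  · rw [min_eq_left h, max_eq_right h]; ring
  · rw [min_eq_right h, max_eq_left h]; ring

theorem openInterval_self_left {a b ξ : EReal} (h : a ≤ ξ) :
    openInterval ξ b = openInterval a b ∩ {x : ℝ | ξ < x} := by
  ext x
  simp only [openInterval, Set.mem_ofPred_eq, Set.mem_inter_iff]
  exact ⟨fun hx => ⟨⟨h.trans_lt hx.1, hx.2⟩, hx.1⟩, fun hx => ⟨hx.2, hx.1.2⟩⟩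

theorem openInterval_self_right {a b ξ : EReal} (h : ξ ≤ b) :
    openInterval a ξ = openInterval a b ∩ {x : ℝ | (x : EReal) < ξ} := by
  ext x
  simp only [openInterval, Set.mem_ofPred_eq, Set.mem_inter_iff]
  exact ⟨fun hx => ⟨⟨hx.1, hx.2.trans_le h⟩, hx.2⟩, fun hx => ⟨hx.1.1, hx.2⟩⟩

theorem openInterval_coe_left {a b : EReal} {ξ : ℝ} (h : a ≤ ξ) :
    openInterval ξ b = openInterval a b ∩ Set.Ioi ξ := by
  rw [openInterval_self_left h]
  simp [Set.Ioi]

theorem openInterval_coe_right {a b : EReal} {ξ : ℝ} (h : (ξ : EReal) ≤ b) :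
    openInterval a ξ = openInterval a b ∩ Set.Iio ξ := by
  rw [openInterval_self_right h]
  simp [Set.Iio]

theorem iteratedDeriv_eqOn {U : Set ℝ} (hU : IsOpen U) {F G : ℝ → ℝ} (h : Set.EqOn F G U) (k : ℕ) :
    Set.EqOn (iteratedDeriv k F) (iteratedDeriv k G) U := fun _ hx =>
  (h.eventuallyEq_of_mem (hU.mem_nhds hx)).iteratedDeriv_eq k

/-- On the left the signs `(-1) ^ m` and `(-1) ^ (m + 2)` cancel, so the top derivative itself is
decreasing and convex there. If `ξ` is an end point, one half is the whole interval; otherwise `ξ`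
is real and the halves are glued. -/
theorem IsWrightDecomposition.convexOn_iteratedDeriv {m : ℕ} {a b ξ : EReal} {f M₁ M₂ P : ℝ → ℝ}
    {Q : Polynomial ℝ} (h : IsWrightDecomposition (m + 1) a b ξ f M₁ M₂ Q P) :
    ConvexOn ℝ (openInterval a b) (iteratedDeriv m fun x => M₁ x + M₂ x) := by
  have hl : Set.EqOn (iteratedDeriv m fun x => M₁ x + M₂ x)
      (fun x => (-1) ^ m * iteratedDeriv m (fun x => (-1) ^ (m + 1 + 1) * M₁ x) x)
      (openInterval a ξ) := by
    intro x hx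
    rw [iteratedDeriv_eqOn (isOpen_openInterval a ξ) (G := M₁)
      (fun y hy => by simp [h.zero_left y hy]) m hx]
    dsimp only
    rw [iteratedDeriv_const_mul_field, ← mul_assoc, ← pow_add,
      Even.neg_one_pow ⟨m + 1, by ring⟩, one_mul]
  have hr : Set.EqOn (iteratedDeriv m fun x => M₁ x + M₂ x) (iteratedDeriv m M₂)
      (openInterval ξ b) :=
    iteratedDeriv_eqOn (isOpen_openInterval ξ b) (fun y hy => by simp [h.zero_right y hy]) m
  obtain ⟨-, -, hlm, hlc⟩ : _ ∧ _ := ⟨h.monotone_left.1, h.monotone_left.2 m le_rfl⟩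
  obtain ⟨-, -, hrm, hrc⟩ : _ ∧ _ := ⟨h.monotone_right.1, h.monotone_right.2 m le_rfl⟩
  have hlm' := hlm.congr hl.symm
  have hlc' := hlc.congr hl.symm
  have hrm' := hrm.congr hr.symm
  have hrc' := hrc.congr hr.symm
  rcases h.left_le.eq_or_lt with rfl | haξ
  · exact hrc'
  rcases h.le_right.eq_or_lt with rfl | hξb
  · exact hlc'
  lift ξ to ℝ using ⟨(hξb.trans_le le_top).ne, (bot_le.trans_lt haξ).ne'⟩
  rw [openInterval_coe_left haξ.le] at hrm' hrc'
  rw [openInterval_coe_right hξb.le] at hlm' hlc'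
  exact convexOn_of_antitoneOn_of_monotoneOn (ordConnected_openInterval a b)
    (isOpen_openInterval a b) (continuousOn_iteratedDeriv (isOpen_openInterval a b) h.glue)
    ⟨haξ, hξb⟩ hlc' hlm' hrc' hrm'

theorem IsWrightDecomposition.wrightConvexOn {m : ℕ} {a b ξ : EReal} {f M₁ M₂ P : ℝ → ℝ}
    {Q : Polynomial ℝ} (h : IsWrightDecomposition (m + 1) a b ξ f M₁ M₂ Q P) :
    WrightConvexOn (m + 1) (openInterval a b) f := by
  intro hs hl hpos x hx hxs
  have hI := ordConnected_openInterval a b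
  have hR := WrightConvexOn.of_convexOn_iteratedDeriv hI (isOpen_openInterval a b) h.glue
    (h.convexOn_iteratedDeriv) hs hl hpos x hx hxs
  change 0 ≤ multiDiff hs f x
  rw [multiDiff_congr hI (G := fun x => (M₁ x + M₂ x) + Q.eval x + P x) h.eq_sum hpos hx hxs,
    multiDiff_add, multiDiff_add hs (fun x => M₁ x + M₂ x),
    h.polynomialFunction.multiDiff_eq_zero hl,
    (isPolynomialFunction_polynomial h.degree_le).multiDiff_eq_zero hl, add_zero, add_zero]
  exact hR

/-! ### Slopes of order `n` with rational steps -/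

section Slopes

variable {I : Set ℝ} {n : ℕ} {f : ℝ → ℝ}

theorem WrightConvexOn.multiDiff_le (hf : WrightConvexOn n I f) {hs : List ℝ}
    (hl : hs.length = n) (hpos : ∀ h ∈ hs, 0 < h) {x y : ℝ} (hx : x ∈ I) (hxy : x ≤ y)
    (hy : y + hs.sum ∈ I) : multiDiff hs f x ≤ multiDiff hs f y := by
  rcases hxy.eq_or_lt with rfl | hlt
  · rfl
  have h := hf ((y - x) :: hs) (by simp [hl])
    (by simpa using ⟨hlt, hpos⟩) x hx (by simpa [← add_assoc] using hy)
  change 0 ≤ fwdDiff (y - x) (multiDiff hs f) x at h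
  rw [fwdDiff, add_sub_cancel] at h
  linarith

theorem WrightConvexOn.iterate_fwdDiff_le (hf : WrightConvexOn n I f) {h : ℝ} (hh : 0 < h)
    {x y : ℝ} (hx : x ∈ I) (hxy : x ≤ y) (hy : y + n * h ∈ I) :
    (fwdDiff h)^[n] f x ≤ (fwdDiff h)^[n] f y := by
  rw [← multiDiff_replicate]
  refine hf.multiDiff_le (by simp) (fun k hk => ?_) hx hxy (by simpa using hy)
  rw [List.eq_of_mem_replicate hk]
  exact hh

theorem iterate_succ_fwdDiff_natCast_mul (N j m : ℕ) (h : ℝ) (F : ℝ → ℝ) (x : ℝ) :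
    (fwdDiff (N * h))^[j + 1] ((fwdDiff h)^[m] F) x =
      ∑ i ∈ Finset.range N, (fwdDiff (N * h))^[j] ((fwdDiff h)^[m + 1] F) (x + i * h) := by
  rw [Function.iterate_succ_apply', fwdDiff_natCast_mul]
  refine Finset.sum_congr rfl fun i _ => ?_
  have := iterate_fwdDiff_comm 1 j h (N * h) ((fwdDiff h)^[m] F)
  simp only [Function.iterate_one] at this
  rw [this, Function.iterate_succ_apply']

/-- Each coarse step splits into `N` fine ones, so the right-hand side is a sum of `N ^ j` fine
differences of order `n`, all based to the right of `x'`. The induction trades one coarse step for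
one fine step. -/
theorem WrightConvexOn.le_refine (hf : WrightConvexOn n I f) (hI : I.OrdConnected) {N : ℕ}
    {h : ℝ} (hh : 0 < h) {x' : ℝ} (hx' : x' ∈ I) (j m : ℕ) (hjm : j + m = n) (x : ℝ)
    (hx : x' ≤ x) (hxI : x + (j * N + m) * h ∈ I) :
    N ^ j * (fwdDiff h)^[n] f x' ≤ (fwdDiff (N * h))^[j] ((fwdDiff h)^[m] f) x := by
  induction j generalizing m x with
  | zero =>
    obtain rfl : m = n := by omega
    simpa using hf.iterate_fwdDiff_le hh hx' hx (by simpa using hxI)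
  | succ j ih =>
    rw [iterate_succ_fwdDiff_natCast_mul]
    have := Finset.card_nsmul_le_sum (Finset.range N)
      (fun i : ℕ => (fwdDiff (N * h))^[j] ((fwdDiff h)^[m + 1] f) (x + i * h))
      (N ^ j * (fwdDiff h)^[n] f x') fun i hi => ?_
    · refine le_of_eq_of_le ?_ this
      rw [Finset.card_range, nsmul_eq_mul]
      ring
    · have hi' : (i : ℝ) + 1 ≤ N := by exact_mod_cast Finset.mem_range.1 hi
      have h1 : (0 : ℝ) ≤ i * h := by positivity
      have h2 : (0 : ℝ) ≤ (j * N + m) * h := by positivity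
      refine ih (m + 1) (by omega) _ (by linarith) (hI.mem_of_le hx' hxI ?_ ?_)
      · push_cast; nlinarith
      · push_cast; nlinarith

theorem WrightConvexOn.refine_le (hf : WrightConvexOn n I f) (hI : I.OrdConnected) {N : ℕ}
    {h : ℝ} (hh : 0 < h) {y : ℝ} (hy : y + n * h ∈ I) (j m : ℕ) (hjm : j + m = n) (x : ℝ)
    (hx : x ∈ I) (hxy : x + j * N * h ≤ y) :
    (fwdDiff (N * h))^[j] ((fwdDiff h)^[m] f) x ≤ N ^ j * (fwdDiff h)^[n] f y := by
  induction j generalizing m x with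
  | zero =>
    obtain rfl : m = n := by omega
    simpa using hf.iterate_fwdDiff_le hh hx (by simpa using hxy) hy
  | succ j ih =>
    rw [iterate_succ_fwdDiff_natCast_mul]
    have := Finset.sum_le_card_nsmul (Finset.range N)
      (fun i : ℕ => (fwdDiff (N * h))^[j] ((fwdDiff h)^[m + 1] f) (x + i * h))
      (N ^ j * (fwdDiff h)^[n] f y) fun i hi => ?_
    · refine this.trans_eq ?_
      rw [Finset.card_range, nsmul_eq_mul]
      ring
    · have hi' : (i : ℝ) + 1 ≤ N := by exact_mod_cast Finset.mem_range.1 hi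
      have h1 : (0 : ℝ) ≤ i * h := by positivity
      have h2 : (0 : ℝ) ≤ j * N * h := by positivity
      have h3 : (0 : ℝ) ≤ n * h := by positivity
      push_cast at hxy
      have h4 : x + i * h + j * N * h ≤ y := by nlinarith
      exact ih (m + 1) (by omega) _ (hI.mem_of_le hx hy (by linarith) (by linarith)) h4

theorem exists_common_denominator (q r : ℚ) (hq : 0 < q) (hr : 0 < r) :
    ∃ (N M : ℕ) (h : ℝ), 0 < N ∧ 0 < M ∧ 0 < h ∧ (q : ℝ) = N * h ∧ (r : ℝ) = M * h := by
  refine ⟨q.num.toNat * r.den, r.num.toNat * q.den, 1 / (q.den * r.den), ?_, ?_, ?_, ?_, ?_⟩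
  · have := Rat.num_pos.2 hq
    have := r.den_pos
    exact Nat.mul_pos (by omega) this
  · have := Rat.num_pos.2 hr
    have := q.den_pos
    exact Nat.mul_pos (by omega) this
  · have := q.den_pos
    have := r.den_pos
    positivity
  · have h1 : ((q.num.toNat : ℤ) : ℝ) = q.num := by
      rw [Int.toNat_of_nonneg (Rat.num_pos.2 hq).le]
    have := q.den_ne_zero
    have := r.den_ne_zero
    push_cast at h1 ⊢
    rw [h1, Rat.cast_def]
    field_simp
  · have h1 : ((r.num.toNat : ℤ) : ℝ) = r.num := by
      rw [Int.toNat_of_nonneg (Rat.num_pos.2 hr).le]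
    have := q.den_ne_zero
    have := r.den_ne_zero
    push_cast at h1 ⊢
    rw [h1, Rat.cast_def]
    field_simp

/-- With a common refinement `h` of `q` and `r`, each slope is an average of slopes with step `h`.
The slope at `y` with step `h` separates the two averages. Rationality is what supplies `h`. -/
theorem WrightConvexOn.slope_le_slope (hf : WrightConvexOn n I f) (hI : I.OrdConnected)
    {q r : ℚ} (hq : 0 < q) (hr : 0 < r) {x y : ℝ} (hx : x ∈ I) (hxy : x + n * q ≤ y)
    (hy : y + n * r ∈ I) :
    (fwdDiff (q : ℝ))^[n] f x / q ^ n ≤ (fwdDiff (r : ℝ))^[n] f y / r ^ n := by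
  obtain ⟨N, M, h, hN, hM, hh, hqN, hrM⟩ := exists_common_denominator q r hq hr
  have hN' : (1 : ℝ) ≤ N := by exact_mod_cast hN
  have hM' : (1 : ℝ) ≤ M := by exact_mod_cast hM
  have hq' : (0 : ℝ) < q := by exact_mod_cast hq
  have hr' : (0 : ℝ) < r := by exact_mod_cast hr
  have hnq : (0 : ℝ) ≤ n * q := by positivity
  have hnr : (0 : ℝ) ≤ n * r := by positivity
  have hyI : y ∈ I := hI.mem_of_le hx hy (by linarith) (by linarith)
  have hnh : (0 : ℝ) ≤ n * h := by positivity
  have hyh : y + n * h ∈ I := hI.mem_of_le hyI hy (by linarith) (by rw [hrM]; nlinarith)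
  have h1 := hf.refine_le hI (N := N) hh hyh n 0 (add_zero n) x hx
    (by rw [mul_assoc, ← hqN]; exact hxy)
  have h2 := hf.le_refine hI (N := M) hh hyI n 0 (add_zero n) y le_rfl
    (by rw [Nat.cast_zero, add_zero, mul_assoc, ← hrM]; exact hy)
  rw [← hqN, Function.iterate_zero_apply] at h1
  rw [← hrM, Function.iterate_zero_apply] at h2
  have e1 : (fwdDiff (q : ℝ))^[n] f x / q ^ n ≤ (fwdDiff h)^[n] f y / h ^ n := by
    rw [div_le_div_iff₀ (by positivity) (by positivity)]
    calc _ ≤ (N ^ n * (fwdDiff h)^[n] f y) * h ^ n := by gcongr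
      _ = _ := by rw [hqN, mul_pow]; ring
  refine e1.trans ?_
  rw [div_le_div_iff₀ (by positivity) (by positivity)]
  calc _ = (M ^ n * (fwdDiff h)^[n] f y) * h ^ n := by rw [hrM, mul_pow]; ring
    _ ≤ _ := by gcongr

/-- The infimum of the slopes `Δ_q^n f (x) / q^n` over the admissible rational steps `q > 0`. For
an `n`-Wright-convex `f` it plays the role of the right derivative of order `n` of the regular part
of `f`. -/
noncomputable def infSlope (n : ℕ) (I : Set ℝ) (f : ℝ → ℝ) (x : ℝ) : ℝ :=
  sInf ((fun q : ℚ => (fwdDiff (q : ℝ))^[n] f x / (q : ℝ) ^ n) '' {q | 0 < q ∧ x + n * q ∈ I})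

theorem exists_rat_mem (hIo : IsOpen I) (n : ℕ) {x : ℝ} (hx : x ∈ I) :
    ∃ q : ℚ, 0 < q ∧ x + n * q ∈ I ∧ x - n * q ∈ I := by
  obtain ⟨ε, hε, hball⟩ := Metric.isOpen_iff.1 hIo x hx
  obtain ⟨q, hq0, hq⟩ := exists_rat_btwn (show 0 < ε / (n + 1) by positivity)
  have hq0' : (0 : ℝ) < q := hq0
  rw [lt_div_iff₀ (by positivity)] at hq
  have : (n : ℝ) * q < ε := by nlinarith
  have h0 : (0 : ℝ) ≤ n * q := by positivity
  refine ⟨q, by exact_mod_cast hq0, hball ?_, hball ?_⟩ <;>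
    rw [Metric.mem_ball, Real.dist_eq, abs_lt] <;> constructor <;> linarith

theorem WrightConvexOn.infSlope_le (hf : WrightConvexOn n I f) (hI : I.OrdConnected)
    (hIo : IsOpen I) {q : ℚ} (hq : 0 < q) {x : ℝ} (hx : x ∈ I) (hxq : x + n * q ∈ I) :
    infSlope n I f x ≤ (fwdDiff (q : ℝ))^[n] f x / q ^ n := by
  refine csInf_le ?_ ⟨q, ⟨hq, hxq⟩, rfl⟩
  -- A slope taken entirely to the left of `x` bounds all the slopes at `x` from below.
  obtain ⟨r, hr, -, hxr⟩ := exists_rat_mem hIo n hx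
  refine ⟨(fwdDiff (r : ℝ))^[n] f (x - n * r) / r ^ n, ?_⟩
  rintro _ ⟨s, ⟨hs, hxs⟩, rfl⟩
  exact hf.slope_le_slope hI hr hs hxr (by simp) hxs

theorem WrightConvexOn.le_infSlope (hf : WrightConvexOn n I f) (hI : I.OrdConnected)
    (hIo : IsOpen I) {q : ℚ} (hq : 0 < q) {x : ℝ} (hx : x ∈ I) (hxq : x + n * q ∈ I) :
    (fwdDiff (q : ℝ))^[n] f x / q ^ n ≤ infSlope n I f (x + n * q) := by
  obtain ⟨r, hr, hxr, -⟩ := exists_rat_mem hIo n hxq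
  refine le_csInf ⟨_, r, ⟨hr, hxr⟩, rfl⟩ ?_
  rintro _ ⟨s, ⟨hs, hxs⟩, rfl⟩
  exact hf.slope_le_slope hI hq hs hx le_rfl hxs

/-- A step admissible at `y` is admissible at `x ≤ y`, and for a fixed step the slope increases with
its base point. -/
theorem WrightConvexOn.monotoneOn_infSlope (hf : WrightConvexOn n I f) (hI : I.OrdConnected)
    (hIo : IsOpen I) : MonotoneOn (infSlope n I f) I := by
  intro x hx y hy hxy
  obtain ⟨r, hr, hyr, -⟩ := exists_rat_mem hIo n hy
  refine le_csInf ⟨_, r, ⟨hr, hyr⟩, rfl⟩ ?_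
  rintro _ ⟨s, ⟨hs, hys⟩, rfl⟩
  have hs' : (0 : ℝ) < s := by exact_mod_cast hs
  have h0 : (0 : ℝ) ≤ n * s := by positivity
  refine (hf.infSlope_le hI hIo hs hx
    (hI.mem_of_le hx hys (by linarith) (by linarith))).trans ?_
  have := hf.iterate_fwdDiff_le hs' hx hxy hys
  dsimp only
  gcongr

end Slopes

/-! ### Iterated primitives of a monotone function -/

section Primitive

open MeasureTheory

/-- The primitive of order `k` of `D` with base point `ξ`. -/
noncomputable def iteratedPrimitive (ξ : ℝ) (D : ℝ → ℝ) : ℕ → ℝ → ℝ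
  | 0 => D
  | k + 1 => fun x => ∫ t in ξ..x, iteratedPrimitive ξ D k t

variable {I : Set ℝ} {ξ : ℝ} {D : ℝ → ℝ}

theorem exists_lt_lt_mem (hIo : IsOpen I) {x : ℝ} (hx : x ∈ I) :
    ∃ u ∈ I, ∃ v ∈ I, u < x ∧ x < v := by
  obtain ⟨ε, hε, hball⟩ := Metric.isOpen_iff.1 hIo x hx
  refine ⟨x - ε / 2, hball ?_, x + ε / 2, hball ?_, by linarith, by linarith⟩ <;>
    rw [Metric.mem_ball, Real.dist_eq, abs_lt] <;> constructor <;> linarith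

theorem continuousOn_primitive (hIo : IsOpen I) (hξ : ξ ∈ I) {F : ℝ → ℝ}
    (hF : ∀ x ∈ I, ∀ y ∈ I, IntervalIntegrable F volume x y) :
    ContinuousOn (fun x => ∫ t in ξ..x, F t) I := by
  intro x hx
  obtain ⟨u, hu, v, hv, hux, hxv⟩ := exists_lt_lt_mem hIo hx
  have hl : min u ξ ∈ I := by rcases min_choice u ξ with h | h <;> rw [h] <;> assumption
  have hr : max v ξ ∈ I := by rcases max_choice v ξ with h | h <;> rw [h] <;> assumption
  have hlx : min u ξ < x := (min_le_left _ _).trans_lt hux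
  have hxr : x < max v ξ := hxv.trans_le (le_max_left _ _)
  have hlr : min u ξ ≤ max v ξ := (hlx.trans hxr).le
  have h := intervalIntegral.continuousOn_primitive_interval' (a := ξ) (hF _ hl _ hr) (by
    rw [Set.uIcc_of_le hlr]
    exact ⟨min_le_right _ _, le_max_right _ _⟩)
  rw [Set.uIcc_of_le hlr] at h
  exact (h.continuousAt (Icc_mem_nhds hlx hxr)).continuousWithinAt

theorem intervalIntegrable_iteratedPrimitive (hI : I.OrdConnected) (hIo : IsOpen I) (hξ : ξ ∈ I)
    (hD : MonotoneOn D I) (k : ℕ) :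
    ∀ x ∈ I, ∀ y ∈ I, IntervalIntegrable (iteratedPrimitive ξ D k) volume x y := by
  induction k with
  | zero => exact fun x hx y hy => (hD.mono (hI.uIcc_subset hx hy)).intervalIntegrable
  | succ k ih =>
    exact fun x hx y hy =>
      ((continuousOn_primitive hIo hξ ih).mono (hI.uIcc_subset hx hy)).intervalIntegrable

theorem continuousOn_iteratedPrimitive_succ (hI : I.OrdConnected) (hIo : IsOpen I) (hξ : ξ ∈ I)
    (hD : MonotoneOn D I) (k : ℕ) : ContinuousOn (iteratedPrimitive ξ D (k + 1)) I :=
  continuousOn_primitive hIo hξ (intervalIntegrable_iteratedPrimitive hI hIo hξ hD k)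

/-- Differentiability starts with the second primitive: `D` may jump, so the first is in general
only continuous. -/
theorem hasDerivAt_iteratedPrimitive (hI : I.OrdConnected) (hIo : IsOpen I) (hξ : ξ ∈ I)
    (hD : MonotoneOn D I) (k : ℕ) {x : ℝ} (hx : x ∈ I) :
    HasDerivAt (iteratedPrimitive ξ D (k + 2)) (iteratedPrimitive ξ D (k + 1) x) x := by
  have hc := continuousOn_iteratedPrimitive_succ hI hIo hξ hD k
  exact intervalIntegral.integral_hasDerivAt_right
    (intervalIntegrable_iteratedPrimitive hI hIo hξ hD (k + 1) ξ hξ x hx)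
    (hc.stronglyMeasurableAtFilter hIo x hx) (hc.continuousAt (hIo.mem_nhds hx))

theorem contDiffOn_iteratedPrimitive (hI : I.OrdConnected) (hIo : IsOpen I) (hξ : ξ ∈ I)
    (hD : MonotoneOn D I) (m : ℕ) : ContDiffOn ℝ m (iteratedPrimitive ξ D (m + 1)) I := by
  induction m with
  | zero => exact contDiffOn_zero.2 (continuousOn_iteratedPrimitive_succ hI hIo hξ hD 0)
  | succ m ih =>
    rw [Nat.cast_succ, contDiffOn_succ_iff_deriv_of_isOpen hIo]
    refine ⟨fun x hx => (hasDerivAt_iteratedPrimitive hI hIo hξ hD m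
      hx).differentiableAt.differentiableWithinAt, by simp, ih.congr fun x hx =>
        (hasDerivAt_iteratedPrimitive hI hIo hξ hD m hx).deriv⟩

theorem iteratedDeriv_iteratedPrimitive (hI : I.OrdConnected) (hIo : IsOpen I) (hξ : ξ ∈ I)
    (hD : MonotoneOn D I) (k j : ℕ) :
    Set.EqOn (iteratedDeriv k (iteratedPrimitive ξ D (j + k + 1)))
      (iteratedPrimitive ξ D (j + 1)) I := by
  induction k generalizing j with
  | zero => intro x _; simp
  | succ k ih =>
    intro x hx
    have h := ih (j + 1)
    rw [show j + 1 + k + 1 = j + (k + 1) + 1 by ring] at h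
    rw [iteratedDeriv_succ, (h.eventuallyEq_of_mem (hIo.mem_nhds hx)).deriv_eq]
    exact (hasDerivAt_iteratedPrimitive hI hIo hξ hD j hx).deriv

theorem iterate_fwdDiff_primitive (hI : I.OrdConnected) (hξ : ξ ∈ I) {F : ℝ → ℝ}
    (hF : ∀ x ∈ I, ∀ y ∈ I, IntervalIntegrable F volume x y) {h : ℝ} (hh : 0 < h) (j : ℕ) {x : ℝ}
    (hx : x ∈ I) (hxj : x + (j + 1) * h ∈ I) :
    IntervalIntegrable (fun t => (fwdDiff h)^[j] F (x + t)) volume 0 h ∧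
    (fwdDiff h)^[j + 1] (fun x => ∫ t in ξ..x, F t) x =
      ∫ t in 0..h, (fwdDiff h)^[j] F (x + t) := by
  induction j generalizing x with
  | zero =>
    simp only [CharP.cast_eq_zero, zero_add, one_mul] at hxj
    simp only [Function.iterate_zero, id_eq, zero_add, Function.iterate_one, fwdDiff]
    refine ⟨?_, ?_⟩
    · have := (hF x hx (x + h) hxj).comp_add_left x
      simpa using this
    · rw [intervalIntegral.integral_interval_sub_left (hF _ hξ _ hxj) (hF _ hξ _ hx),
        intervalIntegral.integral_comp_add_left, add_zero]
  | succ j ih =>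
    push_cast at hxj
    have h0 : 0 ≤ (j : ℝ) * h := by positivity
    have h1 := ih hx (hI.mem_of_le hx hxj (by nlinarith) (by nlinarith))
    have h2 := ih (x := x + h) (hI.mem_of_le hx hxj (by nlinarith) (by nlinarith))
      (by convert hxj using 1; ring)
    have e : (fun t => (fwdDiff h)^[j + 1] F (x + t)) =
        fun t => (fwdDiff h)^[j] F (x + h + t) - (fwdDiff h)^[j] F (x + t) := by
      funext t
      rw [Function.iterate_succ_apply', fwdDiff, add_right_comm]
    rw [e]
    refine ⟨h2.1.sub h1.1, ?_⟩
    rw [Function.iterate_succ_apply', fwdDiff, h1.2, h2.2, intervalIntegral.integral_sub h2.1 h1.1]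

/-- A difference of a primitive is the integral over `[0, h]` of shifted differences of one order
less. By induction and monotonicity each integration contributes a factor `h` to both bounds. -/
theorem iterate_fwdDiff_iteratedPrimitive (hI : I.OrdConnected) (hIo : IsOpen I) (hξ : ξ ∈ I)
    (hD : MonotoneOn D I) {h : ℝ} (hh : 0 < h) (k : ℕ) {x : ℝ} (hx : x ∈ I)
    (hxk : x + k * h ∈ I) :
    h ^ k * D x ≤ (fwdDiff h)^[k] (iteratedPrimitive ξ D k) x ∧
      (fwdDiff h)^[k] (iteratedPrimitive ξ D k) x ≤ h ^ k * D (x + k * h) := by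
  induction k generalizing x with
  | zero => simp [iteratedPrimitive]
  | succ k ih =>
    push_cast at hxk
    obtain ⟨hint, heq⟩ := iterate_fwdDiff_primitive hI hξ
      (intervalIntegrable_iteratedPrimitive hI hIo hξ hD k) hh k hx hxk
    have h0 : 0 ≤ (k : ℝ) * h := by positivity
    change h ^ (k + 1) * D x ≤
        (fwdDiff h)^[k + 1] (fun x => ∫ t in ξ..x, iteratedPrimitive ξ D k t) x ∧
      (fwdDiff h)^[k + 1] (fun x => ∫ t in ξ..x, iteratedPrimitive ξ D k t) x ≤ _
    rw [heq]
    have hmem : ∀ t ∈ Set.Icc 0 h, x + t ∈ I ∧ x + t + k * h ∈ I := fun t ht =>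
      ⟨hI.mem_of_le hx hxk (by linarith [ht.1]) (by nlinarith [ht.2]),
        hI.mem_of_le hx hxk (by linarith [ht.1]) (by nlinarith [ht.2])⟩
    have hconst : ∀ c : ℝ, ∫ _ in (0 : ℝ)..h, c = h * c := fun c => by simp
    constructor
    · rw [pow_succ', mul_assoc, ← hconst]
      refine intervalIntegral.integral_mono_on hh.le (by simp) hint fun t ht => ?_
      obtain ⟨m1, m2⟩ := hmem t ht
      refine le_trans ?_ (ih m1 m2).1
      have := hD hx m1 (by linarith [ht.1])
      gcongr
    · rw [pow_succ', mul_assoc, ← hconst]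
      refine intervalIntegral.integral_mono_on hh.le hint (by simp) fun t ht => ?_
      obtain ⟨m1, m2⟩ := hmem t ht
      refine (ih m1 m2).2.trans ?_
      push_cast
      have := hD m2 hxk (by nlinarith [ht.2])
      gcongr

/-- The mean of `F` over `[x, y]` is at most `F y`, which is at most its mean over `[y, z]`; `F`
need not be continuous. -/
theorem convexOn_primitive {U : Set ℝ} (hU : Convex ℝ U) {F : ℝ → ℝ}
    (hF : ∀ x ∈ U, ∀ y ∈ U, IntervalIntegrable F volume x y)
    (hF' : ∀ x ∈ U, IntervalIntegrable F volume ξ x)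
    (hm : MonotoneOn F U) : ConvexOn ℝ U (fun x => ∫ t in ξ..x, F t) := by
  refine convexOn_of_slope_mono_adjacent hU fun {x y z} hx hz hxy hyz => ?_
  have hy : y ∈ U := hU.ordConnected.mem_of_le hx hz hxy.le hyz.le
  have h1 : ∫ t in x..y, F t ≤ (y - x) * F y := by
    have : ∫ _ in x..y, F y = (y - x) * F y := by simp
    rw [← this]
    exact intervalIntegral.integral_mono_on hxy.le (hF x hx y hy) (by simp) fun t ht =>
      hm (hU.ordConnected.mem_of_le hx hy ht.1 ht.2) hy ht.2
  have h2 : (z - y) * F y ≤ ∫ t in y..z, F t := by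
    have : ∫ _ in y..z, F y = (z - y) * F y := by simp
    rw [← this]
    exact intervalIntegral.integral_mono_on hyz.le (by simp) (hF y hy z hz) fun t ht =>
      hm hy (hU.ordConnected.mem_of_le hy hz ht.1 ht.2) ht.1
  rw [intervalIntegral.integral_interval_sub_left (hF' _ hy) (hF' _ hx),
    intervalIntegral.integral_interval_sub_left (hF' _ hz) (hF' _ hy)]
  rw [div_le_div_iff₀ (by linarith) (by linarith)]
  have e1 := mul_le_mul_of_nonneg_right h1 (show 0 ≤ z - y by linarith)
  have e2 := mul_le_mul_of_nonneg_right h2 (show 0 ≤ y - x by linarith)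
  linarith

/-- To the right of `ξ` all primitives of a monotone function vanishing at `ξ` are non-negative and
monotone. -/
theorem iteratedPrimitive_right (hI : I.OrdConnected) (hIo : IsOpen I) (hξ : ξ ∈ I)
    (hD : MonotoneOn D I) (hD0 : D ξ = 0) (k : ℕ) :
    (∀ x ∈ I, ξ ≤ x → 0 ≤ iteratedPrimitive ξ D k x) ∧
      MonotoneOn (iteratedPrimitive ξ D k) (I ∩ Set.Ioi ξ) := by
  induction k with
  | zero =>
    exact ⟨fun x hx h => hD0 ▸ hD hξ hx h, hD.mono Set.inter_subset_left⟩
  | succ k ih =>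
    have hint := intervalIntegrable_iteratedPrimitive hI hIo hξ hD k
    have key : ∀ x ∈ I, ∀ y ∈ I, ξ ≤ x → x ≤ y →
        0 ≤ ∫ t in x..y, iteratedPrimitive ξ D k t := fun x hx y hy h hxy =>
      intervalIntegral.integral_nonneg hxy fun t ht =>
        ih.1 t (hI.mem_of_le hx hy ht.1 ht.2) (h.trans ht.1)
    refine ⟨fun x hx h => key ξ hξ x hx le_rfl h, fun x hx y hy hxy => ?_⟩
    have h1 := key x hx.1 y hy.1 (le_of_lt hx.2) hxy
    rw [← intervalIntegral.integral_interval_sub_left (hint _ hξ _ hy.1) (hint _ hξ _ hx.1)] at h1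
    exact sub_nonneg.1 h1

/-- To the left of `ξ` the integral from `ξ` runs backwards, so each integration reverses the sign.
-/
theorem iteratedPrimitive_left (hI : I.OrdConnected) (hIo : IsOpen I) (hξ : ξ ∈ I)
    (hD : MonotoneOn D I) (hD0 : D ξ = 0) (k : ℕ) :
    (∀ x ∈ I, x ≤ ξ → 0 ≤ (-1) ^ (k + 1) * iteratedPrimitive ξ D k x) ∧
      AntitoneOn (fun x => (-1) ^ (k + 1) * iteratedPrimitive ξ D k x) (I ∩ Set.Iio ξ) := by
  induction k with
  | zero =>
    refine ⟨fun x hx h => ?_, fun x hx y hy hxy => ?_⟩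
    · simpa [iteratedPrimitive, hD0] using hD hx hξ h
    · simpa [iteratedPrimitive] using hD hx.1 hy.1 hxy
  | succ k ih =>
    have hint := intervalIntegrable_iteratedPrimitive hI hIo hξ hD k
    have key : ∀ x ∈ I, ∀ y ∈ I, x ≤ y → y ≤ ξ →
        0 ≤ (-1) ^ (k + 1) * ∫ t in x..y, iteratedPrimitive ξ D k t := by
      intro x hx y hy hxy h
      rw [← intervalIntegral.integral_const_mul]
      exact intervalIntegral.integral_nonneg hxy fun t ht =>
        ih.1 t (hI.mem_of_le hx hy ht.1 ht.2) (ht.2.trans h)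
    refine ⟨fun x hx h => ?_, fun x hx y hy hxy => ?_⟩
    · have h1 := key x hx ξ hξ h le_rfl
      rw [intervalIntegral.integral_symm] at h1
      simp only [iteratedPrimitive]
      rw [pow_succ]
      linarith
    · have h1 := key x hx.1 y hy.1 hxy (le_of_lt hy.2)
      rw [← intervalIntegral.integral_interval_sub_left (hint _ hξ _ hy.1) (hint _ hξ _ hx.1)] at h1
      simp only [iteratedPrimitive]
      rw [pow_succ]
      linarith

theorem convexOn_iteratedPrimitive_right (hI : I.OrdConnected) (hIo : IsOpen I) (hξ : ξ ∈ I)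
    (hD : MonotoneOn D I) (hD0 : D ξ = 0) (k : ℕ) :
    ConvexOn ℝ (I ∩ Set.Ioi ξ) (iteratedPrimitive ξ D (k + 1)) := by
  have hint := intervalIntegrable_iteratedPrimitive hI hIo hξ hD k
  exact convexOn_primitive (hI.convex.inter (convex_Ioi ξ)) (fun x hx y hy => hint x hx.1 y hy.1)
    (fun x hx => hint ξ hξ x hx.1) (iteratedPrimitive_right hI hIo hξ hD hD0 k).2

theorem convexOn_iteratedPrimitive_left (hI : I.OrdConnected) (hIo : IsOpen I) (hξ : ξ ∈ I)
    (hD : MonotoneOn D I) (hD0 : D ξ = 0) (k : ℕ) :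
    ConvexOn ℝ (I ∩ Set.Iio ξ) (fun x => (-1) ^ k * iteratedPrimitive ξ D (k + 1) x) := by
  have hint := intervalIntegrable_iteratedPrimitive hI hIo hξ hD k
  have hm := (iteratedPrimitive_left hI hIo hξ hD hD0 k).2.neg
  have := convexOn_primitive (ξ := ξ) (F := fun x => (-1) ^ k * iteratedPrimitive ξ D k x)
    (hI.convex.inter (convex_Iio ξ)) (fun x hx y hy => (hint x hx.1 y hy.1).const_mul _)
    (fun x hx => (hint ξ hξ x hx.1).const_mul _) (by
      refine hm.congr fun x _ => ?_
      simp [pow_succ])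
  simp only [intervalIntegral.integral_const_mul] at this
  exact this

end Primitive

/-! ### Vanishing of the differences of the remainder -/

section Vanishing

variable {I : Set ℝ} {n : ℕ} {g : ℝ → ℝ}

/-- The sum splits into `n` telescoping sums, each at most `B - A`. The bound does not depend on
`N`. -/
theorem sum_range_shift_sub_le {u : ℕ → ℝ} {A B : ℝ} (n N : ℕ) (hA : ∀ i < N + n, A ≤ u i)
    (hB : ∀ i < N + n, u i ≤ B) :
    ∑ i ∈ Finset.range N, (u (i + n) - u i) ≤ n * (B - A) := by
  induction n with
  | zero => simp
  | succ n ih =>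
    have h1 := ih (fun i hi => hA i (by omega)) (fun i hi => hB i (by omega))
    have h2 := Finset.sum_range_sub (fun i => u (i + n)) N
    have h3 : ∑ i ∈ Finset.range N, (u (i + (n + 1)) - u i) =
        ∑ i ∈ Finset.range N, (u (i + n) - u i) +
          ∑ i ∈ Finset.range N, (u (i + 1 + n) - u (i + n)) := by
      rw [← Finset.sum_add_distrib]
      refine Finset.sum_congr rfl fun i _ => ?_
      rw [add_right_comm i 1 n, add_assoc i n 1]
      ring
    have h4 := hA (0 + n) (by omega)
    have h5 := hB (N + n) (by omega)
    rw [h3, h2]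
    push_cast
    linarith

/-- The errors along the first coarse step telescope and cost no factor `N`; each further coarse
step costs one. Hence `N ^ j` in the bound, against `N ^ (j + 1)` in the main term. -/
theorem abs_iterate_fwdDiff_sub_le (hI : I.OrdConnected) {D : ℝ → ℝ} (hD : MonotoneOn D I) {c : ℝ}
    {h : ℝ} (hh : 0 < h)
    (hg : ∀ x ∈ I, x + n * h ∈ I →
      |(fwdDiff h)^[n] g x - h ^ n * c| ≤ h ^ n * (D (x + n * h) - D x))
    {x₀ x₁ : ℝ} (h₀ : x₀ ∈ I) (h₁ : x₁ ∈ I) (N j m : ℕ) (hjm : j + 1 + m = n) (x : ℝ)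
    (hx : x₀ ≤ x) (hx' : x + ((j + 1) * N + m) * h ≤ x₁) :
    |(fwdDiff (N * h))^[j + 1] ((fwdDiff h)^[m] g) x - N ^ (j + 1) * (h ^ n * c)| ≤
      N ^ j * (h ^ n * (n * (D x₁ - D x₀))) := by
  have hmem : ∀ y, x₀ ≤ y → y ≤ x₁ → y ∈ I := fun y => hI.mem_of_le h₀ h₁
  induction j generalizing m x with
  | zero =>
    obtain rfl : n = m + 1 := by omega
    rw [iterate_succ_fwdDiff_natCast_mul]
    simp only [Function.iterate_zero, id_eq, zero_add, pow_one, pow_zero, one_mul,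
      CharP.cast_eq_zero] at hx' ⊢
    have hpt : ∀ i : ℕ, i < N + (m + 1) → x₀ ≤ x + i * h ∧ x + i * h ≤ x₁ := by
      intro i hi
      have h1 : (i : ℝ) ≤ N + m := by exact_mod_cast Nat.le_of_lt_succ hi
      have h2 : (0 : ℝ) ≤ i * h := by positivity
      exact ⟨by linarith, by nlinarith⟩
    have e : ∑ i ∈ Finset.range N, (fwdDiff h)^[m + 1] g (x + i * h) - N * (h ^ (m + 1) * c) =
        ∑ i ∈ Finset.range N, ((fwdDiff h)^[m + 1] g (x + i * h) - h ^ (m + 1) * c) := by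
      rw [Finset.sum_sub_distrib, Finset.sum_const, Finset.card_range, nsmul_eq_mul]
    rw [e]
    refine (Finset.abs_sum_le_sum_abs _ _).trans ?_
    have hb : ∀ i ∈ Finset.range N,
        |(fwdDiff h)^[m + 1] g (x + i * h) - h ^ (m + 1) * c| ≤
          h ^ (m + 1) * (D (x + (i + (m + 1) : ℕ) * h) - D (x + i * h)) := by
      intro i hi
      have hi' := Finset.mem_range.1 hi
      have p1 := hpt i (by omega)
      have p2 := hpt (i + (m + 1)) (by omega)
      have e2 : x + (i + (m + 1) : ℕ) * h = x + i * h + (m + 1 : ℕ) * h := by push_cast; ring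
      rw [e2] at p2 ⊢
      exact hg _ (hmem _ p1.1 p1.2) (hmem _ p2.1 p2.2)
    refine (Finset.sum_le_sum hb).trans ?_
    rw [← Finset.mul_sum]
    refine mul_le_mul_of_nonneg_left ?_ (by positivity)
    exact sum_range_shift_sub_le (u := fun i : ℕ => D (x + i * h)) (m + 1) N
      (fun i hi => hD h₀ (hmem _ (hpt i hi).1 (hpt i hi).2) (hpt i hi).1)
      (fun i hi => hD (hmem _ (hpt i hi).1 (hpt i hi).2) h₁ (hpt i hi).2)
  | succ j ih =>
    rw [iterate_succ_fwdDiff_natCast_mul]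
    have e : ∑ i ∈ Finset.range N,
          (fwdDiff (N * h))^[j + 1] ((fwdDiff h)^[m + 1] g) (x + i * h) -
            N ^ (j + 1 + 1) * (h ^ n * c) =
        ∑ i ∈ Finset.range N, ((fwdDiff (N * h))^[j + 1] ((fwdDiff h)^[m + 1] g) (x + i * h) -
            N ^ (j + 1) * (h ^ n * c)) := by
      rw [Finset.sum_sub_distrib, Finset.sum_const, Finset.card_range, nsmul_eq_mul]
      ring
    rw [e]
    refine (Finset.abs_sum_le_sum_abs _ _).trans ?_
    refine (Finset.sum_le_card_nsmul _ _ (N ^ j * (h ^ n * (n * (D x₁ - D x₀)))) ?_).trans_eq ?_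
    · intro i hi
      have hi' : (i : ℝ) + 1 ≤ N := by exact_mod_cast Finset.mem_range.1 hi
      have h1 : (0 : ℝ) ≤ i * h := by positivity
      push_cast at hx'
      refine ih (m + 1) (by omega) _ (by linarith) ?_
      push_cast
      nlinarith
    · rw [Finset.card_range, nsmul_eq_mul]
      ring

/-- Cutting `d` into `N + 1` equal parts bounds the error by `K / (N + 1)`, with `K` independent of
`N`. -/
theorem iterate_fwdDiff_eq_of_abs_le (hn : 1 ≤ n) (hI : I.OrdConnected) {D : ℝ → ℝ}
    (hD : MonotoneOn D I) {c : ℝ}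
    (hg : ∀ q : ℚ, 0 < q → ∀ x ∈ I, x + n * q ∈ I →
      |(fwdDiff (q : ℝ))^[n] g x - q ^ n * c| ≤ q ^ n * (D (x + n * q) - D x))
    {d : ℚ} (hd : 0 < d) {x : ℝ} (hx : x ∈ I) (hxd : x + n * d ∈ I) :
    (fwdDiff (d : ℝ))^[n] g x = d ^ n * c := by
  obtain ⟨j, rfl⟩ := Nat.exists_eq_add_of_le' hn
  set K := (d : ℝ) ^ (j + 1) * ((j + 1 : ℕ) * (D (x + (j + 1 : ℕ) * d) - D x)) with hK
  have key : ∀ N : ℕ, |(fwdDiff (d : ℝ))^[j + 1] g x - d ^ (j + 1) * c| ≤ K / ((N : ℝ) + 1) := by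
    intro N
    have hN : ((N + 1 : ℕ) : ℝ) ≠ 0 := by positivity
    have hq : 0 < d / (N + 1 : ℕ) := by positivity
    have hNq : ((N + 1 : ℕ) : ℝ) * ((d / (N + 1 : ℕ) : ℚ) : ℝ) = d := by
      push_cast at hN ⊢
      field_simp
    have h := abs_iterate_fwdDiff_sub_le hI hD (h := ((d / (N + 1 : ℕ) : ℚ) : ℝ))
      (by exact_mod_cast hq) (hg _ hq) hx hxd (N + 1) j 0 (by omega) x le_rfl (by
        rw [Nat.cast_zero, add_zero, mul_assoc, hNq]
        push_cast
        exact le_rfl)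
    rw [hNq, Function.iterate_zero_apply] at h
    have e1 : ((N + 1 : ℕ) : ℝ) ^ (j + 1) * (((d / (N + 1 : ℕ) : ℚ) : ℝ) ^ (j + 1) * c) =
        d ^ (j + 1) * c := by rw [← mul_assoc, ← mul_pow, hNq]
    have e2 : ((N + 1 : ℕ) : ℝ) ^ j * (((d / (N + 1 : ℕ) : ℚ) : ℝ) ^ (j + 1) *
        ((j + 1 : ℕ) * (D (x + (j + 1 : ℕ) * d) - D x))) = K / ((N : ℝ) + 1) := by
      rw [hK]
      push_cast at hN ⊢
      rw [div_pow]
      field_simp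
      ring
    rwa [e1, e2] at h
  have hlim : Filter.Tendsto (fun N : ℕ => K / ((N : ℝ) + 1)) Filter.atTop (nhds 0) := by
    simpa [div_eq_mul_inv] using (tendsto_one_div_add_atTop_nhds_zero_nat (𝕜 := ℝ)).const_mul K
  exact sub_eq_zero.1 (abs_eq_zero.1 (le_antisymm (ge_of_tendsto' hlim key) (abs_nonneg _)))

/-- Steps that are multiples of `d` are traded one by one for sums of shifted `d`-differences, until
`N` equal steps remain. -/
theorem multiDiff_iterate_eq_zero_of_multiples (hI : I.OrdConnected) {N : ℕ} {d : ℝ} (hd : 0 < d)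
    (hg : ∀ x ∈ I, x + N * d ∈ I → (fwdDiff d)^[N] g x = 0) (ks : List ℝ)
    (hks : ∀ k ∈ ks, ∃ m : ℕ, k = m * d) (j : ℕ) (hj : ks.length + j = N) (x : ℝ) (hx : x ∈ I)
    (hxs : x + ks.sum + j * d ∈ I) : multiDiff ks ((fwdDiff d)^[j] g) x = 0 := by
  induction ks generalizing j x with
  | nil =>
    obtain rfl : j = N := by simpa using hj
    exact hg x hx (by simpa using hxs)
  | cons k ks ih =>
    obtain ⟨m, rfl⟩ := hks k (by simp)
    have hks' : ∀ k ∈ ks, ∃ m : ℕ, k = m * d := fun k hk => hks k (by simp [hk])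
    have hs0 : 0 ≤ ks.sum := List.sum_nonneg fun k hk => by
      obtain ⟨m, rfl⟩ := hks' k hk
      positivity
    rw [multiDiff_cons, fwdDiff_natCast_mul]
    refine Finset.sum_eq_zero fun i hi => ?_
    rw [← multiDiff_fwdDiff, ← Function.iterate_succ_apply' (f := fwdDiff d)]
    have hi' : (i : ℝ) + 1 ≤ m := by exact_mod_cast Finset.mem_range.1 hi
    have h1 : (0 : ℝ) ≤ i * d := by positivity
    have h2 : (0 : ℝ) ≤ j * d := by positivity
    rw [List.sum_cons] at hxs
    refine ih hks' (j + 1) (by simp only [List.length_cons] at hj; omega) _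
      (hI.mem_of_le hx hxs (by linarith) (by nlinarith)) (hI.mem_of_le hx hxs ?_ ?_)
    · push_cast; nlinarith
    · push_cast; nlinarith

theorem exists_list_common_denominator (ks : List ℝ) (hks : ∀ k ∈ ks, ∃ q : ℚ, 0 < q ∧ k = q) :
    ∃ N : ℕ, 0 < N ∧ ∀ k ∈ ks, ∃ m : ℕ, k = m * (((1 / N : ℚ)) : ℝ) := by
  induction ks with
  | nil => exact ⟨1, one_pos, by simp⟩
  | cons k ks ih =>
    obtain ⟨N, hN, h⟩ := ih fun k hk => hks k (by simp [hk])
    obtain ⟨q, hq, rfl⟩ := hks k (by simp)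
    have hqd := q.den_pos
    have hN' : (N : ℝ) ≠ 0 := by positivity
    have hq' : (q.den : ℝ) ≠ 0 := by positivity
    refine ⟨N * q.den, Nat.mul_pos hN hqd, fun l hl => ?_⟩
    rcases List.mem_cons.1 hl with rfl | hl
    · refine ⟨q.num.toNat * N, ?_⟩
      have h1 : ((q.num.toNat : ℤ) : ℝ) = q.num := by
        rw [Int.toNat_of_nonneg (Rat.num_pos.2 hq).le]
      push_cast at h1 ⊢
      rw [h1, Rat.cast_def]
      field_simp
    · obtain ⟨m, rfl⟩ := h l hl
      refine ⟨m * q.den, ?_⟩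
      push_cast
      field_simp

theorem multiDiff_eq_zero_of_rational (hI : I.OrdConnected)
    (hg : ∀ q : ℚ, 0 < q → ∀ x ∈ I, x + (n + 1 : ℕ) * q ∈ I → (fwdDiff (q : ℝ))^[n + 1] g x = 0)
    {ks : List ℝ} (hks : ∀ k ∈ ks, ∃ q : ℚ, 0 < q ∧ k = q) (hl : ks.length = n + 1) {x : ℝ}
    (hx : x ∈ I) (hxs : x + ks.sum ∈ I) : multiDiff ks g x = 0 := by
  obtain ⟨N, hN, h⟩ := exists_list_common_denominator ks hks
  have hq : (0 : ℚ) < 1 / N := by positivity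
  exact multiDiff_iterate_eq_zero_of_multiples hI (by exact_mod_cast hq) (hg _ hq) ks h 0
    (by simpa using hl) x hx (by simpa using hxs)

/-- Rational steps are replaced by real ones one at a time. The difference of order `n` that remains
has all rational periods; the lower bound makes it increasing, and an increasing function with
rational periods is constant. -/
theorem multiDiff_eq_zero_of_ge_continuous (hI : I.OrdConnected) (hIo : IsOpen I) {R : ℝ → ℝ}
    (hR : ContinuousOn R I)
    (hg : ∀ q : ℚ, 0 < q → ∀ x ∈ I, x + (n + 1 : ℕ) * q ∈ I → (fwdDiff (q : ℝ))^[n + 1] g x = 0)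
    (hge : ∀ hs : List ℝ, hs.length = n + 1 → (∀ h ∈ hs, 0 < h) → ∀ x ∈ I, x + hs.sum ∈ I →
      -multiDiff hs R x ≤ multiDiff hs g x)
    (hs qs : List ℝ) (hl : hs.length + qs.length = n + 1) (hpos : ∀ h ∈ hs, 0 < h)
    (hqs : ∀ k ∈ qs, ∃ q : ℚ, 0 < q ∧ k = q) (x : ℝ) (hx : x ∈ I) (hxs : x + (hs ++ qs).sum ∈ I) :
    multiDiff (hs ++ qs) g x = 0 := by
  induction hs generalizing qs x with
  | nil => exact multiDiff_eq_zero_of_rational hI hg hqs (by simpa using hl) hx hxs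
  | cons h hs ih =>
    have hp : ∀ k ∈ hs, 0 < k := fun k hk => hpos k (by simp [hk])
    have h0 : 0 < h := hpos h (by simp)
    have hp' : ∀ k ∈ hs ++ qs, 0 < k := fun k hk => by
      rcases List.mem_append.1 hk with hk | hk
      · exact hp k hk
      · obtain ⟨q, hq, rfl⟩ := hqs k hk
        exact_mod_cast hq
    have hs0 := sum_nonneg_of_pos hp'
    have hlen : (hs ++ qs).length = n := by
      simp only [List.length_append, List.length_cons] at hl ⊢
      omega
    have hper : ∀ d : ℚ, 0 < d → ∀ y ∈ I, y + d + (hs ++ qs).sum ∈ I →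
        multiDiff (hs ++ qs) g (y + d) = multiDiff (hs ++ qs) g y := by
      intro d hd y hy hyd
      have := ih ((d : ℝ) :: qs) (by simp only [List.length_cons] at hl ⊢; omega) hp
        (fun k hk => by
          rcases List.mem_cons.1 hk with rfl | hk
          · exact ⟨d, hd, rfl⟩
          · exact hqs k hk) y hy (by
          simp only [List.sum_append, List.sum_cons] at hyd ⊢
          convert hyd using 1
          ring)
      rw [multiDiff_perm List.perm_middle] at this
      exact sub_eq_zero.1 this
    -- A rational period `d` just below `k` reduces the increment over `k` to one over `k - d`,
    -- whose lower bound is small by continuity of `R`.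
    have hmono : ∀ k : ℝ, 0 < k → ∀ y ∈ I, y + k + (hs ++ qs).sum ∈ I →
        multiDiff (hs ++ qs) g y ≤ multiDiff (hs ++ qs) g (y + k) := by
      intro k hk y hy hyk
      have hcont := continuousAt_multiDiff hI hIo hR hp' hy
        (hI.mem_of_le hy hyk (by linarith) (by linarith))
      refine le_of_forall_pos_le_add fun ε hε => ?_
      obtain ⟨δ, hδ, hball⟩ := Metric.continuousAt_iff.1 hcont ε hε
      obtain ⟨d, hd1, hd2⟩ := exists_rat_btwn (show max 0 (k - δ) < k from
        max_lt hk (by linarith))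
      have hd0 : (0 : ℝ) < d := (le_max_left _ _).trans_lt hd1
      have hdδ : k - δ < d := (le_max_right _ _).trans_lt hd1
      have e1 := hper d (by exact_mod_cast hd0) (y + (k - d))
        (hI.mem_of_le hy hyk (by linarith) (by linarith))
        (by convert hyk using 1; ring)
      rw [add_assoc, sub_add_cancel] at e1
      have e2 := hge ((k - d) :: (hs ++ qs)) (by simp only [List.length_cons, hlen])
        (by
          intro l hl
          rcases List.mem_cons.1 hl with rfl | hl
          · linarith
          · exact hp' l hl) y hy
        (by rw [List.sum_cons]; exact hI.mem_of_le hy hyk (by linarith) (by linarith))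
      have e3 := hball (x := y + (k - d)) (by
        rw [Real.dist_eq, abs_lt]; constructor <;> linarith)
      rw [Real.dist_eq, abs_lt] at e3
      simp only [multiDiff_cons, fwdDiff] at e2
      rw [e1]
      linarith [e3.2]
    have hxs' : x + h + (hs ++ qs).sum ∈ I := by
      rw [List.cons_append, List.sum_cons, ← add_assoc] at hxs
      exact hxs
    have hxh : x + h ∈ I := hI.mem_of_le hx hxs' (by linarith) (by linarith)
    obtain ⟨u, -, v, hv, -, hxv⟩ := exists_lt_lt_mem hIo hxs'
    -- The value at `x + h` is squeezed between those at `x` and `x + d`, which agree because `d` is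
    -- rational.
    obtain ⟨d, hd1, hd2⟩ := exists_rat_btwn (show h < v - x - (hs ++ qs).sum by linarith)
    have hd0 : (0 : ℚ) < d := by exact_mod_cast h0.trans hd1
    have hxd : x + d + (hs ++ qs).sum ∈ I := hI.mem_of_le hx hv (by linarith) (by linarith)
    have e1 := hmono h h0 x hx hxs'
    have e2 := hmono (d - h) (by linarith) (x + h) hxh (by convert hxd using 1; ring)
    rw [show x + h + (d - h) = x + d by ring, hper d hd0 x hx hxd] at e2
    rw [List.cons_append, multiDiff_cons, fwdDiff]
    linarith

end Vanishing

/-! ### Extension of local solutions of the Fréchet equation -/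

section Extension

variable {n : ℕ}

/-- A linear recurrence with leading coefficient one: each value is determined by the `n + 1`
preceding ones. -/
theorem eq_zero_of_iterate_fwdDiff {u : ℝ → ℝ} {r : ℝ} {M : ℕ}
    (hu : ∀ i : ℕ, i + (n + 1) ≤ M → (fwdDiff r)^[n + 1] u (i * r) = 0)
    (h0 : ∀ i : ℕ, i ≤ n → u (i * r) = 0) (i : ℕ) (hi : i ≤ M) : u (i * r) = 0 := by
  induction i using Nat.strong_induction_on with
  | _ i ih =>
    rcases le_or_gt i n with hin | hin
    · exact h0 i hin
    obtain ⟨j, rfl⟩ := Nat.exists_eq_add_of_le' hin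
    have h := hu j hi
    rw [fwdDiff_iter_eq_sum_shift, Finset.sum_range_succ, Finset.sum_eq_zero] at h
    · simp only [Nat.sub_self, pow_zero, Nat.choose_self, Nat.cast_one, mul_one, one_smul,
        zero_add, nsmul_eq_mul, ← add_mul] at h
      push_cast at h ⊢
      exact h
    · intro k hk
      have hk' := Finset.mem_range.1 hk
      have := ih (j + k) (by omega) (by omega)
      push_cast at this
      rw [nsmul_eq_mul, ← add_mul, this, smul_zero]

/-- On each grid `u` equals its interpolation polynomial at the first `n + 1` nodes. Grids of
rational mesh have common refinements, so the polynomial does not depend on the grid. -/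
theorem exists_polynomial_eval_rat {T : Set ℝ} (hT : T.OrdConnected) {ε : ℝ} (hε : 0 < ε)
    (hTε : Set.Icc 0 ε ⊆ T) {u : ℝ → ℝ}
    (hu : ∀ s > 0, ∀ t ∈ T, t + (n + 1 : ℕ) * s ∈ T → (fwdDiff s)^[n + 1] u t = 0) :
    ∃ p : Polynomial ℝ, ∀ q : ℚ, 0 ≤ q → (q : ℝ) ∈ T → u q = p.eval (q : ℝ) := by
  have h0T : (0 : ℝ) ∈ T := hTε ⟨le_rfl, hε.le⟩
  obtain ⟨N, hN⟩ := exists_nat_gt (n / ε)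
  have hN0 : (0 : ℝ) < N := lt_of_le_of_lt (by positivity) hN
  rw [div_lt_iff₀ hε] at hN
  have hinj : ∀ r : ℝ, r ≠ 0 → Set.InjOn (fun i : ℕ => (i : ℝ) * r)
      (Finset.range (n + 1) : Finset ℕ) := by
    intro r hr i _ j _ hij
    exact_mod_cast mul_right_cancel₀ hr hij
  have grid : ∀ r : ℝ, 0 < r → ∃ p : Polynomial ℝ, p.degree < (Finset.range (n + 1)).card ∧
      ∀ i : ℕ, (i : ℝ) * r ∈ T → u (i * r) = p.eval (i * r) := by
    intro r hr
    set p := Lagrange.interpolate (Finset.range (n + 1)) (fun i : ℕ => (i : ℝ) * r)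
      (fun i => u (i * r)) with hp
    have hpd : p.degree < (Finset.range (n + 1)).card :=
      Lagrange.degree_interpolate_lt _ (hinj r hr.ne')
    refine ⟨p, hpd, fun M hM => ?_⟩
    have hpn : p.natDegree ≤ n := by
      rw [Finset.card_range] at hpd
      exact Polynomial.natDegree_le_iff_degree_le.2 (Order.le_of_lt_succ (by exact_mod_cast hpd))
    refine sub_eq_zero.1 (eq_zero_of_iterate_fwdDiff (n := n) (M := M) (r := r)
      (u := fun t => u t - p.eval t) (fun i hi => ?_) (fun i hi => ?_) M le_rfl)
    · rw [← multiDiff_replicate, multiDiff_sub, multiDiff_replicate, multiDiff_replicate,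
        Polynomial.iterate_fwdDiff_eq_zero hpn, sub_zero]
      have hiM : (i : ℝ) + (n + 1 : ℕ) ≤ M := by exact_mod_cast hi
      have h1 : (0 : ℝ) ≤ i * r := by positivity
      have h2 : (0 : ℝ) ≤ (n + 1 : ℕ) * r := by positivity
      exact hu r hr _ (hT.mem_of_le h0T hM h1 (by nlinarith))
        (hT.mem_of_le h0T hM (by positivity) (by nlinarith))
    · exact sub_eq_zero.2 (Lagrange.eval_interpolate_at_node (fun i : ℕ => u (i * r)) (hinj r hr.ne')
        (Finset.mem_range.2 (Nat.lt_succ_of_le hi))).symm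
  obtain ⟨p, hpd, hp⟩ := grid (1 / N) (by positivity)
  refine ⟨p, fun q hq hqT => ?_⟩
  have hd := q.den_pos
  have hd' : (q.den : ℝ) ≠ 0 := by positivity
  -- This grid contains both `q` and the first `n + 1` nodes of mesh `1 / N`, which lie in `[0, ε]`
  -- by the choice of `N`.
  obtain ⟨p', hpd', hp'⟩ := grid (1 / (N * q.den)) (by positivity)
  have hpp : p = p' := by
    refine Polynomial.eq_of_degrees_lt_of_eval_index_eq _ (hinj (1 / N) (by positivity)) hpd hpd'
      fun i hi => ?_
    have hi' : (i : ℝ) ≤ n := by exact_mod_cast Nat.le_of_lt_succ (Finset.mem_range.1 hi)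
    have hiT : (i : ℝ) * (1 / N) ∈ T := hTε ⟨by positivity, by
      rw [mul_one_div, div_le_iff₀ hN0]
      linarith⟩
    have e : ((i * q.den : ℕ) : ℝ) * (1 / (N * q.den)) = i * (1 / N) := by
      push_cast
      field_simp
    have h := hp' (i * q.den)
    rw [e] at h
    rw [← hp i hiT, ← h hiT]
  have e : ((q.num.toNat * N : ℕ) : ℝ) * (1 / (N * q.den)) = q := by
    have h1 : ((q.num.toNat : ℤ) : ℝ) = q.num := by
      rw [Int.toNat_of_nonneg (Rat.num_nonneg.2 hq)]
    push_cast at h1 ⊢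
    rw [h1, Rat.cast_def]
    field_simp
  have h := hp' (q.num.toNat * N)
  rw [e] at h
  rw [hpp, h hqT]

theorem iterate_fwdDiff_neg (m : ℕ) (h : ℝ) (F : ℝ → ℝ) (x : ℝ) :
    (fwdDiff h)^[m] F x = (-1) ^ m * (fwdDiff (-h))^[m] F (x + m * h) := by
  induction m generalizing x with
  | zero => simp
  | succ m ih =>
    rw [Function.iterate_succ_apply', Function.iterate_succ_apply', fwdDiff, fwdDiff, ih, ih]
    rw [show x + h + m * h = x + (m + 1 : ℕ) * h by push_cast; ring,
      show x + (m + 1 : ℕ) * h + -h = x + m * h by push_cast; ring]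
    ring

theorem iterate_fwdDiff_zero (m : ℕ) (F : ℝ → ℝ) (x : ℝ) :
    (fwdDiff 0)^[m + 1] F x = 0 := by
  rw [Function.iterate_succ_apply']
  simp [fwdDiff]

/-- A function satisfying the Fréchet equation on an open interval extends to a polynomial
function on the real line. -/
theorem exists_isPolynomialFunction_extension {I : Set ℝ} (hI : I.OrdConnected) (hIo : IsOpen I)
    {ξ : ℝ} (hξ : ξ ∈ I) {g : ℝ → ℝ}
    (hg : ∀ h > 0, ∀ x ∈ I, x + (n + 1 : ℕ) * h ∈ I → (fwdDiff h)^[n + 1] g x = 0) :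
    ∃ P, IsPolynomialFunction n P ∧ Set.EqOn P g I := by
  -- Rays leave `ξ` in both directions, so steps of either sign are needed.
  have hg' : ∀ h, ∀ x ∈ I, x + (n + 1 : ℕ) * h ∈ I → (fwdDiff h)^[n + 1] g x = 0 := by
    intro h x hx hxh
    rcases lt_trichotomy h 0 with hh | rfl | hh
    · rw [iterate_fwdDiff_neg, hg (-h) (neg_pos.2 hh) _ hxh (by simpa using hx), mul_zero]
    · exact iterate_fwdDiff_zero n g x
    · exact hg h hh x hx hxh
  obtain ⟨ε, hε, hball⟩ := Metric.isOpen_iff.1 hIo ξ hξ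
  have hmem : ∀ y, |y| < ε → ξ + y ∈ I := fun y hy => hball (by
    rwa [Metric.mem_ball, Real.dist_eq, add_sub_cancel_left])
  have hex : ∀ v : ℝ, ∃ p : Polynomial ℝ, ∀ q : ℚ, 0 ≤ q → ξ + q * v ∈ I →
      g (ξ + q * v) = p.eval (q : ℝ) := by
    intro v
    have hTo : {t : ℝ | ξ + t * v ∈ I}.OrdConnected := by
      refine ⟨fun s hs t ht r hr => ?_⟩
      rcases le_total 0 v with hv | hv
      · exact hI.mem_of_le hs ht (by have := hr.1; gcongr) (by have := hr.2; gcongr)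
      · exact hI.mem_of_le ht hs
          (by linarith [mul_le_mul_of_nonpos_right hr.2 hv])
          (by linarith [mul_le_mul_of_nonpos_right hr.1 hv])
    refine exists_polynomial_eval_rat (n := n) (T := {t : ℝ | ξ + t * v ∈ I}) hTo
      (ε := ε / (|v| + 1) / 2) (by positivity) (fun t ht => hmem _ ?_)
      (u := fun t => g (ξ + t * v)) (fun s _ t ht hts => ?_)
    · rw [abs_mul, abs_of_nonneg ht.1]
      have h1 := ht.2
      rw [div_div, le_div_iff₀ (by positivity)] at h1
      nlinarith [abs_nonneg v, ht.1, mul_nonneg ht.1 (abs_nonneg v)]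
    · rw [iterate_fwdDiff_comp_affine]
      refine hg' _ _ ht ?_
      have : ξ + (t + (n + 1 : ℕ) * s) * v ∈ I := hts
      convert this using 1
      ring
  choose p hp using hex
  -- Follow the ray from `ξ` through `x`, on which `g` is polynomial at small rational times, and
  -- evaluate that polynomial at time `1`.
  refine ⟨fun x => (p (x - ξ)).eval 1, fun h x => ?_, fun x hx => ?_⟩
  · set c : ℕ → ℝ := fun k => (-1) ^ (n + 1 - k) * ((n + 1).choose k : ℝ) with hc
    set W : Polynomial ℝ := ∑ k ∈ Finset.range (n + 1 + 1),
      Polynomial.C (c k) * p (x + k • h - ξ) with hW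
    have hWe : ∀ t, W.eval t = ∑ k ∈ Finset.range (n + 1 + 1),
        c k * (p (x + k • h - ξ)).eval t := fun t => by
      rw [hW, Polynomial.eval_finsetSum]
      simp only [Polynomial.eval_mul, Polynomial.eval_C]
    have hsum : ∀ (F : ℝ → ℝ) (r y : ℝ), (fwdDiff r)^[n + 1] F y =
        ∑ k ∈ Finset.range (n + 1 + 1), c k * F (y + k • r) := by
      intro F r y
      rw [fwdDiff_iter_eq_sum_shift]
      refine Finset.sum_congr rfl fun k _ => ?_
      rw [zsmul_eq_mul, hc]
      push_cast
      ring
    -- For small rational `t > 0` the value `W t` is a difference of `g` inside `I`, with step `t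
    -- h`, so it vanishes. `W` thus has infinitely many roots, and its value at `1` is the
    -- difference sought.
    have hW0 : W = 0 := by
      refine Polynomial.eq_zero_of_infinite_isRoot W ?_
      set L := |x - ξ| + (n + 1) * |h| + 1 with hL
      have hL0 : 0 < L := by positivity
      obtain ⟨δ, hδ0, hδ⟩ := exists_rat_btwn (show 0 < ε / L by positivity)
      rw [lt_div_iff₀ hL0] at hδ
      have hδ0' : (0 : ℚ) < δ := by exact_mod_cast hδ0
      refine Set.Infinite.mono ?_ ((Set.Ioo_infinite hδ0').image
        (Rat.cast_injective (α := ℝ)).injOn)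
      rintro _ ⟨q, ⟨hq0, hqδ⟩, rfl⟩
      have hq0' : (0 : ℝ) < q := by exact_mod_cast hq0
      have hqδ' : (q : ℝ) < δ := by exact_mod_cast hqδ
      have hin : ∀ k ≤ n + 1, ξ + q * (x + k • h - ξ) ∈ I := by
        intro k hk
        have hk' : (k : ℝ) ≤ n + 1 := by exact_mod_cast hk
        refine hmem _ ?_
        rw [abs_mul, abs_of_pos hq0', nsmul_eq_mul]
        have h1 : |x + k * h - ξ| ≤ L := by
          rw [show x + k * h - ξ = (x - ξ) + k * h by ring]
          refine (abs_add_le _ _).trans ?_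
          rw [abs_mul, Nat.abs_cast]
          have := mul_le_mul_of_nonneg_right hk' (abs_nonneg h)
          linarith
        calc (q : ℝ) * |x + k * h - ξ| ≤ q * L := by gcongr
          _ < δ * L := by gcongr
          _ < ε := hδ
      change W.eval (q : ℝ) = 0
      rw [hWe, ← hg' (q * h) (ξ + q * (x - ξ)) (by simpa using hin 0 (Nat.zero_le _)) (by
        have := hin (n + 1) le_rfl
        rw [nsmul_eq_mul] at this
        convert this using 1
        ring), hsum]
      refine Finset.sum_congr rfl fun k hk => ?_
      have := hin k (Nat.le_of_lt_succ (Finset.mem_range.1 hk))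
      rw [← hp _ q hq0.le this]
      congr 2
      simp only [nsmul_eq_mul]
      ring
    rw [hsum, ← hWe 1, hW0, Polynomial.eval_zero]
  · have h := hp (x - ξ) 1 zero_le_one (by simpa using hx)
    simpa using h.symm

end Extension

/-! ### Assembling the decomposition -/

section Decomposition

variable {m : ℕ} {I : Set ℝ} {ξ : ℝ} {f : ℝ → ℝ}

/-- The regular part of an `n`-Wright-convex function: it is `n`-convex, and it vanishes at `ξ` with
its derivatives of order less than `n`. -/
noncomputable def wrightRegularPart (n : ℕ) (I : Set ℝ) (ξ : ℝ) (f : ℝ → ℝ) : ℝ → ℝ :=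
  iteratedPrimitive ξ (fun x => infSlope n I f x - infSlope n I f ξ) n

/-- The differences of `f`, and those of the regular part increased by `q ^ n * infSlope n I f ξ`,
lie between the same two bounds; the gap is an increment of `infSlope`, which subdivision removes.
-/
theorem WrightConvexOn.iterate_fwdDiff_sub_regularPart {n : ℕ} (hn : 1 ≤ n)
    (hf : WrightConvexOn n I f) (hI : I.OrdConnected)
    (hIo : IsOpen I) (hξ : ξ ∈ I) {q : ℚ} (hq : 0 < q) {x : ℝ} (hx : x ∈ I)
    (hxq : x + n * q ∈ I) :
    (fwdDiff (q : ℝ))^[n] (fun y => f y - wrightRegularPart n I ξ f y) x =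
      q ^ n * infSlope n I f ξ := by
  have hD := hf.monotoneOn_infSlope hI hIo
  refine iterate_fwdDiff_eq_of_abs_le hn hI hD (fun q hq x hx hxq => ?_) hq hx hxq
  have hq' : (0 : ℝ) < q := by exact_mod_cast hq
  have hD0 : MonotoneOn (fun x => infSlope n I f x - infSlope n I f ξ) I :=
    fun x hx y hy hxy => sub_le_sub_right (hD hx hy hxy) _
  have h1 := hf.infSlope_le hI hIo hq hx hxq
  have h2 := hf.le_infSlope hI hIo hq hx hxq
  rw [le_div_iff₀ (by positivity)] at h1
  rw [div_le_iff₀ (by positivity)] at h2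
  obtain ⟨h3, h4⟩ := iterate_fwdDiff_iteratedPrimitive hI hIo hξ hD0 hq' n hx hxq
  rw [← multiDiff_replicate, multiDiff_sub, multiDiff_replicate, multiDiff_replicate,
    wrightRegularPart, abs_le]
  constructor <;> linarith

theorem WrightConvexOn.exists_polynomialFunction (hf : WrightConvexOn (m + 1) I f)
    (hI : I.OrdConnected) (hIo : IsOpen I) (hξ : ξ ∈ I) :
    ∃ P, IsPolynomialFunction (m + 1) P ∧
      ∀ x ∈ I, f x = wrightRegularPart (m + 1) I ξ f x + P x := by
  set R := wrightRegularPart (m + 1) I ξ f with hR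
  have hD := hf.monotoneOn_infSlope hI hIo
  have hcont : ContinuousOn R I := continuousOn_iteratedPrimitive_succ hI hIo hξ
    (fun x hx y hy hxy => sub_le_sub_right (hD hx hy hxy) _) m
  have hrat : ∀ q : ℚ, 0 < q → ∀ x ∈ I, x + (m + 1 + 1 : ℕ) * q ∈ I →
      (fwdDiff (q : ℝ))^[m + 1 + 1] (fun y => f y - R y) x = 0 := by
    intro q hq x hx hxq
    have hq' : (0 : ℝ) < q := by exact_mod_cast hq
    push_cast at hxq
    have h0 : (0 : ℝ) ≤ m * q := by positivity
    rw [Function.iterate_succ_apply', fwdDiff,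
      hf.iterate_fwdDiff_sub_regularPart (by omega) hI hIo hξ hq hx
        (hI.mem_of_le hx hxq (by push_cast; nlinarith) (by push_cast; nlinarith)),
      hf.iterate_fwdDiff_sub_regularPart (by omega) hI hIo hξ hq
        (hI.mem_of_le hx hxq (by linarith) (by nlinarith))
        (by push_cast; convert hxq using 1; ring), sub_self]
  have hge : ∀ hs : List ℝ, hs.length = m + 1 + 1 → (∀ h ∈ hs, 0 < h) → ∀ x ∈ I,
      x + hs.sum ∈ I → -multiDiff hs R x ≤ multiDiff hs (fun y => f y - R y) x := by
    intro hs hl hpos x hx hxs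
    have h : 0 ≤ multiDiff hs f x := hf hs hl hpos x hx hxs
    rw [multiDiff_sub]
    linarith
  obtain ⟨P, hP, hPg⟩ := exists_isPolynomialFunction_extension (n := m + 1) hI hIo hξ
    (g := fun y => f y - R y) fun h hh x hx hxh => by
      have := multiDiff_eq_zero_of_ge_continuous hI hIo hcont hrat hge
        (List.replicate (m + 1 + 1) h) [] (by simp)
        (fun k hk => by rw [List.eq_of_mem_replicate hk]; exact hh) (by simp) x hx (by
          simp only [List.append_nil, List.sum_replicate, nsmul_eq_mul]
          exact hxh)
      rwa [List.append_nil, multiDiff_replicate] at this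
  refine ⟨P, hP, fun x hx => ?_⟩
  rw [hPg hx]
  ring

/-- Splitting the regular part of `f` at its base point `ξ`. Subtracting the Taylor polynomial at
`ξ`, including its term of order `n`, makes both halves monotone of order `n + 1`. A polynomial of
degree at most `n` is a polynomial function of degree at most `n`, so this Taylor polynomial may be
counted in `P`, and `Q = 0`. In general its term of order `n` cannot be counted in `Q`: for `n = 1`
and `f x = -log (-x)` on `(-∞, 0)`, no decomposition with `P = 0` is normalized. -/
theorem WrightConvexOn.exists_isWrightDecomposition {a b : EReal} (hab : a < b)
    (hf : WrightConvexOn (m + 1) (openInterval a b) f) :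
    ∃ (ξ : EReal) (M₁ M₂ : ℝ → ℝ) (Q : Polynomial ℝ) (P : ℝ → ℝ),
      IsWrightDecomposition (m + 1) a b ξ f M₁ M₂ Q P ∧
        IsNormalized (m + 1) a b ξ M₁ M₂ Q := by
  -- Any real point of the interval serves as `ξ`.
  obtain ⟨ξ, haξ, hξb⟩ := EReal.lt_iff_exists_real_btwn.1 hab
  have hI := ordConnected_openInterval a b
  have hIo := isOpen_openInterval a b
  have hξ : ξ ∈ openInterval a b := ⟨haξ, hξb⟩
  obtain ⟨P, hP, hfP⟩ := hf.exists_polynomialFunction hI hIo hξ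
  set D := fun x => infSlope (m + 1) (openInterval a b) f x -
    infSlope (m + 1) (openInterval a b) f ξ with hDdef
  have hD : MonotoneOn D (openInterval a b) := fun x hx y hy hxy =>
    sub_le_sub_right (hf.monotoneOn_infSlope hI hIo hx hy hxy) _
  have hD0 : D ξ = 0 := sub_self _
  set R := iteratedPrimitive ξ D (m + 1) with hR
  have hRs : ContDiffOn ℝ m R (openInterval a b) := contDiffOn_iteratedPrimitive hI hIo hξ hD m
  have hRc : ContinuousAt R ξ :=
    (continuousOn_iteratedPrimitive_succ hI hIo hξ hD m).continuousAt (hIo.mem_nhds hξ)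
  have hl := openInterval_coe_right (a := a) hξb.le
  have hr := openInterval_coe_left (b := b) haξ.le
  set M₁ : ℝ → ℝ := fun x => if x < ξ then R x else 0 with hM₁
  set M₂ : ℝ → ℝ := fun x => if x < ξ then 0 else R x with hM₂
  have hsum : (fun x => M₁ x + M₂ x) = R := by
    funext x
    simp only [hM₁, hM₂]
    split_ifs <;> simp
  have hM₁R : Set.EqOn M₁ R (Set.Iio ξ) := fun x hx => if_pos hx
  have hM₂R : Set.EqOn M₂ R (Set.Ioi ξ) := fun x hx => if_neg (not_lt.2 (le_of_lt hx))
  -- The exponents combine as `k + (j + k + 2) = (j + 2) + 2 k`, leaving exactly the sign of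
  -- `iteratedPrimitive_left` for the primitive of order `j + 1`.
  have hd₁ : ∀ j k, j + k = m → Set.EqOn
      (fun x => (-1) ^ k * iteratedDeriv k (fun x => (-1) ^ (m + 1 + 1) * M₁ x) x)
      (fun x => (-1) ^ (j + 1 + 1) * iteratedPrimitive ξ D (j + 1) x)
      (openInterval a b ∩ Set.Iio ξ) := by
    intro j k hjk x hx
    dsimp only
    rw [iteratedDeriv_const_mul_field, iteratedDeriv_eqOn isOpen_Iio hM₁R k hx.2, hR, ← hjk,
      iteratedDeriv_iteratedPrimitive hI hIo hξ hD k j hx.1, ← mul_assoc, ← pow_add,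
      show k + (j + k + 1 + 1) = j + 1 + 1 + 2 * k by ring, pow_add, pow_mul]
    simp
  have hd₂ : ∀ j k, j + k = m → Set.EqOn (iteratedDeriv k M₂) (iteratedPrimitive ξ D (j + 1))
      (openInterval a b ∩ Set.Ioi ξ) := by
    intro j k hjk x hx
    rw [iteratedDeriv_eqOn isOpen_Ioi hM₂R k hx.2, hR, ← hjk,
      iteratedDeriv_iteratedPrimitive hI hIo hξ hD k j hx.1]
  -- With `Q = 0` the conditions on `c_n` are trivial, and continuity of `R` at `ξ` gives both
  -- one-sided limits the value `R ξ`.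
  refine ⟨ξ, M₁, M₂, 0, P, ⟨haξ.le, hξb.le, ?_, ?_, ?_, ?_, ?_, by simp, hP, ?_⟩,
    ⟨fun _ _ => by simp, fun _ _ => by simp, fun _ _ => ⟨by simp, R ξ, ?_, ?_⟩⟩⟩
  · rw [hl]
    refine ⟨contDiffOn_const.mul
      ((hRs.mono Set.inter_subset_left).congr fun x hx => hM₁R hx.2), fun k hk => ?_⟩
    have hd := hd₁ (m - k) k (Nat.sub_add_cancel hk)
    obtain ⟨h1, h2⟩ := iteratedPrimitive_left hI hIo hξ hD hD0 (m - k + 1)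
    refine ⟨fun x hx => (h1 x hx.1 (le_of_lt hx.2)).trans_eq (hd hx).symm, h2.congr hd.symm, ?_⟩
    refine (convexOn_iteratedPrimitive_left hI hIo hξ hD hD0 (m - k)).congr fun x hx =>
      Eq.trans ?_ (hd hx).symm
    dsimp only
    ring
  · intro x hx
    rw [hr] at hx
    exact if_neg (not_lt.2 (le_of_lt hx.2))
  · rw [hr]
    refine ⟨(hRs.mono Set.inter_subset_left).congr fun x hx => hM₂R hx.2, fun k hk => ?_⟩
    have hd := hd₂ (m - k) k (Nat.sub_add_cancel hk)
    obtain ⟨h1, h2⟩ := iteratedPrimitive_right hI hIo hξ hD hD0 (m - k + 1)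
    refine ⟨fun x hx => ?_, h2.congr hd.symm,
      (convexOn_iteratedPrimitive_right hI hIo hξ hD hD0 (m - k)).congr hd.symm⟩
    rw [hd hx]
    exact h1 x hx.1 (le_of_lt hx.2)
  · intro x hx
    rw [hl] at hx
    exact if_pos hx.2
  · rw [hsum]
    exact hRs
  · intro x hx
    rw [hfP x hx, Polynomial.eval_zero, add_zero]
    exact congrArg (· + P x) (congrFun hsum x).symm
  · rw [EReal.toReal_coe]
    exact (hRc.tendsto.mono_left nhdsWithin_le_nhds).congr'
      (hM₁R.symm.eventuallyEq_of_mem self_mem_nhdsWithin)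
  · rw [EReal.toReal_coe]
    exact (hRc.tendsto.mono_left nhdsWithin_le_nhds).congr'
      (hM₂R.symm.eventuallyEq_of_mem self_mem_nhdsWithin)

end Decomposition

theorem theorem3p4 (n : ℕ) (hn : 1 ≤ n) (a b : EReal) (hab : a < b) (f : ℝ → ℝ) :
    (WrightConvexOn n (openInterval a b) f ↔
      ∃ (ξ : EReal) (M₁ M₂ : ℝ → ℝ) (Q : Polynomial ℝ) (P : ℝ → ℝ),
        IsWrightDecomposition n a b ξ f M₁ M₂ Q P) ∧
    (WrightConvexOn n (openInterval a b) f →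
      ∃ (ξ : EReal) (M₁ M₂ : ℝ → ℝ) (Q : Polynomial ℝ) (P : ℝ → ℝ),
        IsWrightDecomposition n a b ξ f M₁ M₂ Q P ∧ IsNormalized n a b ξ M₁ M₂ Q) := by
  obtain ⟨m, rfl⟩ := Nat.exists_eq_add_of_le' hn
  refine ⟨⟨fun hf => ?_, ?_⟩, fun hf => hf.exists_isWrightDecomposition hab⟩
  · obtain ⟨ξ, M₁, M₂, Q, P, h, -⟩ := hf.exists_isWrightDecomposition hab
    exact ⟨ξ, M₁, M₂, Q, P, h⟩
  · rintro ⟨ξ, M₁, M₂, Q, P, h⟩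
    exact h.wrightConvexOn
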